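/- **Setting.** An *ensemble* is a finite family of orthonormal square-integrable real random variables $X_0=1,X_1,\dots,X_m$; a *sequence of ensembles* $\mathcal X=(\mathcal X_1,\dots,\mathcal X_n)$, $\mathcal X_i=\{X_{i,0}=1,X_{i,1},\dots,X_{i,m_i}\}$, consists of $n$ ensembles on one probability space that are independent of each other. A *multilinear polynomial* is $Q(x)=\sum_{\sigma}c_\sigma\prod_{i=1}^n x_{i,\sigma_i}$, where $\sigma$ ranges over $\mathbb N^n$ and only finitely many real $c_\sigma$ are nonzero; put $|\sigma|=\#\{i:\sigma_i>0\}$, $\deg Q=\max\{|\sigma|:c_\sigma\ne0\}$ (and $\deg 0=0$), and $T_\eta Q=\sum_\sigma\eta^{|\sigma|}c_\sigma\prod_i x_{i,\sigma_i}$. $Q$ is *over* $\mathcal X$ if $\sigma_i\le m_i$ for all $i$ whenever $c_\sigma\neq0$. The sequence $\mathcal X$ is *$(p,q,\eta)$-hypercontractive* if $\|(T_\eta Q)(\mathcal X)\|_q\le\|Q(\mathcal X)\|_p$ for every multilinear polynomial $Q$ over $\mathcal X$. A *$k$-dimensional multilinear polynomial* is $Q=(Q_1,\dots,Q_k)$ with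 each $Q_j$ a multilinear polynomial, and $\deg Q=\max_j\deg Q_j$. Put $$\mathbf{Var}[Q]=\mathbf E\big[\|Q(\mathcal X)-\mathbf E[Q(\mathcal X)]\|_2^2\big],\qquad \mathrm{Inf}_i(Q)=\sum_{j=1}^k\mathbf E\big[\mathbf{Var}[Q_j(\mathcal X)\mid \mathcal X_l,\ l\ne i]\big].$$ **Hypothesis H3.** $\mathcal X$ is a sequence of $n$ ensembles such that, for each $i$, the random variables in $\mathcal X_i$ form a basis of the real-valued functions on a finite probability space $\Omega_i$ (functions that agree outside a set of probability zero being identified). The least nonzero probability of an atom in any of the $\Omega_i$ is $\alpha\le\frac12$, and $\eta=\frac12\alpha^{1/6}$. $\mathcal Y$ is a $(2,3,\eta)$-hypercontractive sequence of $n$ ensembles (for example a Gaussian one) such that all the random variables in $\mathcal Y$ are independent. $Q$ is a $k$-dimensional multilinear polynomial over both $\mathcal X$ and $\mathcal Y$. **Theorem 4.1.** Assume H3. Let $d\in\mathbb N$ and $\tau,B\in\mathbb R$, and assume that $\mathbf{Var}[Q]\le1$, $\deg Q\le d$ and $\mathrm{Inf}_i(Q)\le\tau$ for all $i$. Let $\Psi:\mathbb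 R^k\to\mathbb R$ be a $\mathcal C^3$ function all of whose partial derivatives of order $3$ are bounded by $B$ in absolute value on $\mathbb R^k$. Then $\Psi(Q(\mathcal X))$ and $\Psi(Q(\mathcal Y))$ are integrable and $$\Big|\mathbf E\big[\Psi(Q(\mathcal X))\big]-\mathbf E\big[\Psi(Q(\mathcal Y))\big]\Big|\le 2\,d\,B\,k^3\,\big(8\alpha^{-1/2}\big)^d\,\tau^{1/2}.$$ -/

import Mathlib

open MeasureTheory ProbabilityTheory

noncomputable section

namespace Invariance

/-! ### Multilinear polynomials -/

/-- The degree `|σ|` of a multi-index `σ ∈ ℕⁿ`: the number of `i` with `σ i > 0`. -/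
def multiDegree {n : ℕ} (σ : Fin n → ℕ) : ℕ :=
  (Finset.univ.filter fun i => 0 < σ i).card

/-- A multilinear polynomial `∑ σ, c σ • x_σ` over the indeterminates `x i j`
(`i ∈ [n]`, `j ∈ ℕ`), where `x_σ = ∏ i, x i (σ i)`: the finitely supported family of its
coefficients. -/
abbrev MultilinearPoly (n : ℕ) : Type := (Fin n → ℕ) →₀ ℝ

namespace MultilinearPoly

variable {n : ℕ}

/-- The value of the polynomial at real values of the indeterminates. -/
def eval (Q : MultilinearPoly n) (x : Fin n → ℕ → ℝ) : ℝ :=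
  ∑ σ ∈ Q.support, Q σ * ∏ i, x i (σ i)

/-- The degree `max {|σ| : c σ ≠ 0}`. -/
def degree (Q : MultilinearPoly n) : ℕ := Q.support.sup multiDegree

/-- Only the indeterminates `x i j` with `j ≤ m i` occur in `Q`, so that `Q` can be applied to
ensembles `{X i 0, …, X i (m i)}`. -/
def IsOver (Q : MultilinearPoly n) (m : Fin n → ℕ) : Prop :=
  ∀ σ ∈ Q.support, ∀ i, σ i ≤ m i

/-- The operator `T_ρ Q = ∑ σ, ρ ^ |σ| • c σ • x_σ`. -/
def noise (ρ : ℝ) (Q : MultilinearPoly n) : MultilinearPoly n :=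
  Finsupp.onFinset Q.support (fun σ => ρ ^ multiDegree σ * Q σ) fun _ h =>
    Finsupp.mem_support_iff.2 (right_ne_zero_of_mul h)

/-- The random variable `Q(X)`. -/
def apply {Ω : Type*} (Q : MultilinearPoly n) (X : Fin n → ℕ → Ω → ℝ) (ω : Ω) : ℝ :=
  Q.eval fun i j => X i j ω

end MultilinearPoly

/-- The degree of a vector-valued multilinear polynomial `Q = (Q₁, …, Q_k)`: the maximal degree of
the `Q j`. -/
def vecDegree {n k : ℕ} (Q : Fin k → MultilinearPoly n) : ℕ :=
  Finset.univ.sup fun j => (Q j).degree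

/-- The random vector `Q(X)` for a vector-valued multilinear polynomial `Q`. -/
def vecApply {n k : ℕ} {Ω : Type*} (Q : Fin k → MultilinearPoly n) (X : Fin n → ℕ → Ω → ℝ)
    (ω : Ω) : Fin k → ℝ :=
  fun j => (Q j).apply X ω

/-! ### Ensembles -/

/-- `X` is an (independent) sequence of `n` (orthonormal) ensembles on the probability space
`(Ω, P)`, the `i`-th ensemble being `{X i 0 = 1, X i 1, …, X i (m i)}`. The values `X i j` with
`j > m i` are not part of the sequence and nothing is required of them. -/
structure IsEnsembleSeq {n : ℕ} {Ω : Type*} [MeasurableSpace Ω] (P : Measure Ω)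
    (m : Fin n → ℕ) (X : Fin n → ℕ → Ω → ℝ) : Prop where
  measurable : ∀ i, ∀ j ≤ m i, Measurable (X i j)
  memLp_two : ∀ i, ∀ j ≤ m i, MemLp (X i j) 2 P
  zero_eq_one : ∀ i ω, X i 0 ω = 1
  orthonormal : ∀ i, ∀ j ≤ m i, ∀ j' ≤ m i,
    ∫ ω, X i j ω * X i j' ω ∂P = if j = j' then 1 else 0
  indep : iIndepFun (fun i ω (j : Fin (m i + 1)) => X i j ω) P

/-- The functions `b 0, …, b m` form a basis of the real-valued functions on the finite probability
space `(S, μ)`; as always in probability, functions are identified when they differ only on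
points of probability zero. -/
def IsFunctionBasis {S : Type*} [MeasurableSpace S] (μ : Measure S) (m : ℕ) (b : ℕ → S → ℝ) :
    Prop :=
  ∀ f : S → ℝ, ∃! c : Fin (m + 1) → ℝ, f =ᵐ[μ] fun s => ∑ j, c j * b j s

/-- The sequence of ensembles `X` is `(p, q, η)`-hypercontractive. The norms take values in
`[0, ∞]`, so finiteness of the left-hand side is part of the condition. -/
def IsHypercontractive {n : ℕ} {Ω : Type*} [MeasurableSpace Ω] (P : Measure Ω)
    (m : Fin n → ℕ) (X : Fin n → ℕ → Ω → ℝ) (p q : ENNReal) (η : ℝ) : Prop :=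
  ∀ Q : MultilinearPoly n, Q.IsOver m →
    eLpNorm ((Q.noise η).apply X) q P ≤ eLpNorm (Q.apply X) p P

/-! ### Variance and influences of a vector-valued polynomial -/

/-- `Var[Q(X)] = E[‖Q(X) - E[Q(X)]‖₂²]`. -/
def vecVariance {n k : ℕ} {Ω : Type*} [MeasurableSpace Ω] (P : Measure Ω)
    (X : Fin n → ℕ → Ω → ℝ) (Q : Fin k → MultilinearPoly n) : ℝ :=
  ∫ ω, ∑ j, ((Q j).apply X ω - ∫ ω', (Q j).apply X ω' ∂P) ^ 2 ∂P

/-- The σ-algebra generated by all ensembles of `X` but the `i`-th. -/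
@[reducible] def sigmaExcept {n : ℕ} {Ω : Type*} (m : Fin n → ℕ) (X : Fin n → ℕ → Ω → ℝ) (i : Fin n) :
    MeasurableSpace Ω :=
  ⨆ l : {l : Fin n // l ≠ i}, ⨆ j : Fin (m l + 1),
    MeasurableSpace.comap (X l j) inferInstance

/-- The influence of the `i`-th ensemble,
`Inf_i(Q(X)) = ∑ j, E[Var[Q_j(X) | X_1, …, X_{i-1}, X_{i+1}, …, X_n]]`. -/
def influence {n k : ℕ} {Ω : Type*} [MeasurableSpace Ω] (P : Measure Ω)
    (m : Fin n → ℕ) (X : Fin n → ℕ → Ω → ℝ) (Q : Fin k → MultilinearPoly n) (i : Fin n) : ℝ :=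
  ∑ j, ∫ ω, (condVar (sigmaExcept m X i) ((Q j).apply X) P) ω ∂P

/-! ### Partial derivatives -/

/-- The partial derivative of `Ψ : ℝᵏ → ℝ` with respect to the `a`-th variable. -/
def partialDeriv {k : ℕ} (a : Fin k) (Ψ : (Fin k → ℝ) → ℝ) (x : Fin k → ℝ) : ℝ :=
  fderiv ℝ Ψ x (Pi.single a 1)

end Invariance

end

noncomputable section

namespace Invariance

/-! ### Replacing one coordinate of a product measure -/

section PiUpdate

variable {n : ℕ} {E : Type*} [MeasurableSpace E]

/-! The proof is Lindeberg's replacement method. Independence turns the two sequences into product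
measures on `Fin n → ℕ → ℝ`, and the factors are exchanged one at a time (`abs_integral_pi_sub_le`).
To exchange factor `i`, fix the other coordinates and expand `Ψ` to second order around the part of
`Q` free of block `i`. Each block is orthonormal and contains the constant `1`, so the first two
moments of the increment depend only on the coefficients of `Q`. The two Taylor polynomials
therefore have the same mean, and only two third-order errors survive
(`abs_integral_update_sub_le`).

Each error is a third absolute moment of the part of `Q` that involves block `i`. Hypercontractivity
bounds the `L³` norm of a polynomial of degree at most `d` by `η⁻ᵈ` times its `L²` norm
(`eLpNorm_boxPoly_le`). It is needed for hybrid products mixing both kinds of blocks, so it is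
proved for single blocks and then tensorized (`eLpNorm_sum_prodFun_le`). A block of `Y` inherits it
from the whole sequence. A block of `X` satisfies it because a function on a finite space with atoms
of mass at least `α` is bounded by `α^(-1/2)` times its `L²` norm (`eLpNorm_const_add_mul_le`).

Parseval's identity expresses variance and influences through coefficients
(`IsEnsembleSeq.vecVariance_eq`, `IsEnsembleSeq.influence_eq`). With `V` the influence of block `i`
on one component, an error contributes `η⁻³ᵈ V^(3/2) ≤ (8 α^(-1/2))ᵈ τ^(1/2) V`, and the sum of all
`V` is at most `d` times the variance. -/

theorem isProbabilityMeasure_update (lam : Fin n → Measure E) [∀ i, IsProbabilityMeasure (lam i)]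
    (i : Fin n) (κ : Measure E) [IsProbabilityMeasure κ] (l : Fin n) :
    IsProbabilityMeasure (Function.update lam i κ l) := by
  by_cases h : l = i
  · subst h; simpa
  · simpa [Function.update_of_ne h] using inferInstanceAs (IsProbabilityMeasure (lam l))

/-- The old `i`-th coordinate is overwritten and contributes only mass one. Fubini in a single
coordinate thus needs no splitting of the index set; `κ = lam i` amounts to resampling that
coordinate. -/
theorem measurePreserving_update (lam : Fin n → Measure E) [∀ i, IsProbabilityMeasure (lam i)]
    (i : Fin n) (κ : Measure E) [IsProbabilityMeasure κ] :
    MeasurePreserving (fun p : (Fin n → E) × E => Function.update p.1 i p.2)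
      ((Measure.pi lam).prod κ) (Measure.pi (Function.update lam i κ)) := by
  have hm : Measurable fun p : (Fin n → E) × E => Function.update p.1 i p.2 := by
    refine measurable_pi_lambda _ fun l => ?_
    by_cases h : l = i
    · subst h; simpa using measurable_snd
    · simp only [Function.update_of_ne h]
      exact (measurable_pi_apply l).comp measurable_fst
  have := isProbabilityMeasure_update lam i κ
  refine ⟨hm, (Measure.pi_eq fun s hs => ?_).symm⟩
  rw [Measure.map_apply hm (MeasurableSet.univ_pi hs)]
  have : (fun p : (Fin n → E) × E => Function.update p.1 i p.2) ⁻¹' Set.univ.pi s =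
      (Set.univ.pi (Function.update s i Set.univ)) ×ˢ s i := by
    ext ⟨w, z⟩
    simp only [Set.mem_preimage, Set.mem_pi, Set.mem_univ, forall_true_left, Set.mem_prod]
    constructor
    · intro h
      refine ⟨fun l => ?_, by simpa using h i⟩
      by_cases hl : l = i
      · subst hl; simp
      · simpa [Function.update_of_ne hl] using h l
    · rintro ⟨h1, h2⟩ l
      by_cases hl : l = i
      · subst hl; simpa using h2
      · simpa [Function.update_of_ne hl] using h1 l
  rw [this, Measure.prod_prod, Measure.pi_pi]
  rw [← Finset.mul_prod_erase _ _ (Finset.mem_univ i),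
    ← Finset.mul_prod_erase (f := fun l => Function.update lam i κ l (s l)) _ (Finset.mem_univ i)]
  have : ∏ l ∈ Finset.univ.erase i, (lam l) (Function.update s i Set.univ l) =
      ∏ l ∈ Finset.univ.erase i, (Function.update lam i κ l) (s l) :=
    Finset.prod_congr rfl fun l hl => by
      rw [Function.update_of_ne (Finset.ne_of_mem_erase hl),
        Function.update_of_ne (Finset.ne_of_mem_erase hl)]
  rw [this]
  simp [mul_comm]

end PiUpdate

/-! ### Sums over boxes of multi-indices -/

/-- A multi-index stripped of its `i`-th entry is encoded by setting that entry to `0`, so that all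
monomials keep the same index type. -/
theorem sum_piFinset_eq_sum_update {n : ℕ} {β : Type*} [AddCommMonoid β] (t : Fin n → Finset ℕ)
    (i : Fin n) (F : (Fin n → ℕ) → β) :
    ∑ σ ∈ Fintype.piFinset t, F σ =
      ∑ j ∈ t i, ∑ σ ∈ Fintype.piFinset (Function.update t i {0}), F (Function.update σ i j) := by
  rw [← Finset.sum_product']
  refine Finset.sum_bij' (fun σ _ => (σ i, Function.update σ i 0))
    (fun p _ => Function.update p.2 i p.1) ?_ ?_ ?_ ?_ ?_
  · intro σ hσ
    rw [Fintype.mem_piFinset] at hσ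
    simp only [Finset.mem_product, Fintype.mem_piFinset]
    refine ⟨hσ i, fun l => ?_⟩
    by_cases hl : l = i
    · subst hl; simp
    · simpa [Function.update_of_ne hl] using hσ l
  · rintro ⟨j, σ⟩ h
    simp only [Finset.mem_product, Fintype.mem_piFinset] at h ⊢
    intro l
    by_cases hl : l = i
    · subst hl; simpa using h.1
    · simpa [Function.update_of_ne hl] using h.2 l
  · intro σ _
    simp
  · rintro ⟨j, σ⟩ h
    simp only [Finset.mem_product, Fintype.mem_piFinset] at h
    have h0 : σ i = 0 := by simpa using h.2 i
    simp [← h0]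
  · intro σ _
    simp

theorem eq_zero_of_mem_piFinset_update {n : ℕ} {t : Fin n → Finset ℕ} {i : Fin n}
    {σ : Fin n → ℕ} (h : σ ∈ Fintype.piFinset (Function.update t i {0})) : σ i = 0 := by
  simpa using Fintype.mem_piFinset.1 h i

/-! ### Products of coordinate functions -/

/-- The function `x ↦ ∏ l, u (σ l) (x l)`. -/
def prodFun {n : ℕ} {E : Type*} (u : ℕ → E → ℝ) (σ : Fin n → ℕ) (x : Fin n → E) : ℝ :=
  ∏ l, u (σ l) (x l)

theorem measurable_prodFun {n : ℕ} {E : Type*} [MeasurableSpace E] {u : ℕ → E → ℝ}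
    (hu : ∀ j, Measurable (u j)) (σ : Fin n → ℕ) : Measurable (prodFun u σ) :=
  Finset.measurable_fun_prod _ fun l _ => (hu _).comp (measurable_pi_apply l)

theorem prodFun_update {n : ℕ} {E : Type*} {u : ℕ → E → ℝ} (hu0 : ∀ z, u 0 z = 1)
    {σ : Fin n → ℕ} {i : Fin n} (hσ : σ i = 0) (j : ℕ) (w : Fin n → E) (z : E) :
    prodFun u (Function.update σ i j) (Function.update w i z) = prodFun u σ w * u j z := by
  unfold prodFun
  rw [← Finset.mul_prod_erase _ _ (Finset.mem_univ i),
    ← Finset.mul_prod_erase (f := fun l => u (σ l) (w l)) _ (Finset.mem_univ i)]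
  have : ∏ l ∈ Finset.univ.erase i, u (Function.update σ i j l) (Function.update w i z l) =
      ∏ l ∈ Finset.univ.erase i, u (σ l) (w l) :=
    Finset.prod_congr rfl fun l hl => by
      rw [Function.update_of_ne (Finset.ne_of_mem_erase hl),
        Function.update_of_ne (Finset.ne_of_mem_erase hl)]
  rw [this]
  simp [hσ, hu0, mul_comm]

/-- Expansion of a multilinear polynomial with respect to its `i`-th block of variables. -/
theorem sum_prodFun_update {n : ℕ} {E : Type*} {u : ℕ → E → ℝ} (hu0 : ∀ z, u 0 z = 1)
    (t : Fin n → Finset ℕ) (c : (Fin n → ℕ) → ℝ) (i : Fin n) (w : Fin n → E) (z : E) :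
    ∑ σ ∈ Fintype.piFinset t, c σ * prodFun u σ (Function.update w i z) =
      ∑ j ∈ t i, (∑ σ ∈ Fintype.piFinset (Function.update t i {0}),
        c (Function.update σ i j) * prodFun u σ w) * u j z := by
  rw [sum_piFinset_eq_sum_update t i]
  refine Finset.sum_congr rfl fun j _ => ?_
  rw [Finset.sum_mul]
  refine Finset.sum_congr rfl fun σ hσ => ?_
  rw [prodFun_update hu0 (eq_zero_of_mem_piFinset_update hσ), mul_assoc]

/-! ### Tensorization of hypercontractivity -/

/-- Minkowski's inequality for the `L³` norm of an `ℓ²` norm. -/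
theorem eLpNorm_sqrt_sum_sq_le {Ω ι : Type*} [MeasurableSpace Ω] {μ : Measure Ω} (s : Finset ι)
    {G : ι → Ω → ℝ} {b : ι → ℝ} (hG : ∀ j ∈ s, AEStronglyMeasurable (G j) μ)
    (hb : ∀ j ∈ s, eLpNorm (G j) 3 μ ≤ ENNReal.ofReal (√(b j))) (hb0 : ∀ j ∈ s, 0 ≤ b j) :
    eLpNorm (fun w => √(∑ j ∈ s, G j w ^ 2)) 3 μ ≤ ENNReal.ofReal (√(∑ j ∈ s, b j)) := by
  -- Squaring moves the problem to `L^(3/2)`, where the ordinary triangle inequality applies to the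
  -- sum of squares.
  have key : ∀ f : Ω → ℝ, eLpNorm (fun w => f w ^ 2) (3 / 2) μ = eLpNorm f 3 μ ^ 2 := by
    intro f
    have := eLpNorm_norm_rpow (p := 3 / 2) (q := 2) (μ := μ) f (by norm_num)
    have h3 : (3 / 2 : ENNReal) * ENNReal.ofReal 2 = 3 := by
      simp only [ENNReal.ofReal_ofNat]
      exact ENNReal.div_mul_cancel (by norm_num) (by norm_num)
    rw [h3] at this
    rw [← ENNReal.rpow_two, ← this]
    congr 1
    ext w
    simp
  have h2 : eLpNorm (fun w => √(∑ j ∈ s, G j w ^ 2)) 3 μ ^ 2 ≤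
      ENNReal.ofReal (√(∑ j ∈ s, b j)) ^ 2 := by
    rw [← key, ← ENNReal.ofReal_pow (Real.sqrt_nonneg _), Real.sq_sqrt (Finset.sum_nonneg hb0)]
    have e : (fun w => √(∑ j ∈ s, G j w ^ 2) ^ 2) = ∑ j ∈ s, fun w => G j w ^ 2 := by
      ext w
      rw [Real.sq_sqrt (Finset.sum_nonneg fun j _ => sq_nonneg _), Finset.sum_apply]
    rw [e]
    refine (eLpNorm_sum_le (f := fun j w => G j w ^ 2) (fun j hj => (hG j hj).pow 2) ?_).trans ?_
    · rw [ENNReal.le_div_iff_mul_le] <;> norm_num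
    · rw [ENNReal.ofReal_sum_of_nonneg hb0]
      refine Finset.sum_le_sum fun j hj => ?_
      rw [key]
      calc eLpNorm (G j) 3 μ ^ 2 ≤ ENNReal.ofReal (√(b j)) ^ 2 := by gcongr; exact hb j hj
        _ = ENNReal.ofReal (b j) := by
          rw [← ENNReal.ofReal_pow (Real.sqrt_nonneg _), Real.sq_sqrt (hb0 j hj)]
  exact (ENNReal.pow_le_pow_left_iff two_ne_zero).1 h2

theorem eLpNorm_three_le_iff {Ω Ω' F F' : Type*} [MeasurableSpace Ω] [MeasurableSpace Ω']
    [NormedAddCommGroup F] [NormedAddCommGroup F'] {μ : Measure Ω} {μ' : Measure Ω'}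
    {f : Ω → F} {g : Ω' → F'} :
    eLpNorm f 3 μ ≤ eLpNorm g 3 μ' ↔ ∫⁻ w, ‖f w‖ₑ ^ 3 ∂μ ≤ ∫⁻ w, ‖g w‖ₑ ^ 3 ∂μ' := by
  rw [eLpNorm_eq_lintegral_rpow_enorm_toReal (by norm_num) (by norm_num),
    eLpNorm_eq_lintegral_rpow_enorm_toReal (by norm_num) (by norm_num),
    ENNReal.rpow_le_rpow_iff (by norm_num)]
  simp

theorem lintegral_enorm_pow_three_le {Ω : Type*} [MeasurableSpace Ω] {μ : Measure Ω} {f : Ω → ℝ}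
    {C : ENNReal} (h : eLpNorm f 3 μ ≤ C) : ∫⁻ w, ‖f w‖ₑ ^ 3 ∂μ ≤ C ^ 3 := by
  refine le_trans (le_of_eq ?_) (pow_le_pow_left' h 3)
  rw [eLpNorm_eq_lintegral_rpow_enorm_toReal (by norm_num) (by norm_num),
    ← ENNReal.rpow_natCast, ← ENNReal.rpow_mul]
  simp

/-- Induction on the set `s` of coordinates that may occur. For a new coordinate, apply the
one-block bound with the others frozen; Minkowski's inequality then takes the `ℓ²` sum over that
block out of the `L³` norm, and the induction hypothesis applies to each coefficient `G j`. In the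
application the noise factor `η` is built into `u`. -/
theorem eLpNorm_sum_prodFun_le {n : ℕ} {E : Type*} [MeasurableSpace E] {u : ℕ → E → ℝ}
    (hu : ∀ j, Measurable (u j)) (hu0 : ∀ z, u 0 z = 1)
    (lam : Fin n → Measure E) [∀ i, IsProbabilityMeasure (lam i)] (T : Fin n → Finset ℕ)
    (h1 : ∀ i (c : ℕ → ℝ), eLpNorm (fun z => ∑ j ∈ T i, c j * u j z) 3 (lam i) ≤
      ENNReal.ofReal (√(∑ j ∈ T i, c j ^ 2)))
    (s : Finset (Fin n)) (c : (Fin n → ℕ) → ℝ) :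
    eLpNorm (fun x => ∑ σ ∈ Fintype.piFinset (fun i => if i ∈ s then T i else {0}),
      c σ * prodFun u σ x) 3 (Measure.pi lam) ≤
      ENNReal.ofReal (√(∑ σ ∈ Fintype.piFinset (fun i => if i ∈ s then T i else {0}),
        c σ ^ 2)) := by
  induction s using Finset.induction_on generalizing c with
  | empty =>
    have : Fintype.piFinset (fun i : Fin n => if i ∈ (∅ : Finset (Fin n)) then T i else {0}) =
        {0} := by
      ext σ; simp [funext_iff]
    rw [this]
    simp only [Finset.sum_singleton, prodFun, Pi.zero_apply, hu0, Finset.prod_const_one, mul_one,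
      Real.sqrt_sq_eq_abs]
    rw [eLpNorm_const _ (by norm_num) (IsProbabilityMeasure.ne_zero _)]
    simp [Real.enorm_eq_ofReal_abs]
  | insert i s his ih =>
    set t : Fin n → Finset ℕ := fun l => if l ∈ insert i s then T l else {0} with ht
    have hti : t i = T i := by simp [ht]
    have htu : Function.update t i {0} = fun l => if l ∈ s then T l else {0} := by
      ext1 l
      by_cases hl : l = i
      · subst hl; simp [his]
      · simp [ht, hl]
    set G : ℕ → (Fin n → E) → ℝ := fun j w =>
      ∑ σ ∈ Fintype.piFinset (Function.update t i {0}),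
        c (Function.update σ i j) * prodFun u σ w with hGdef
    have hGm : ∀ j, Measurable (G j) := fun j =>
      Finset.measurable_fun_sum _ fun σ _ => (measurable_prodFun hu σ).const_mul _
    have step : eLpNorm (fun x => ∑ σ ∈ Fintype.piFinset t, c σ * prodFun u σ x) 3
        (Measure.pi lam) ≤ eLpNorm (fun w => √(∑ j ∈ T i, G j w ^ 2)) 3 (Measure.pi lam) := by
      rw [eLpNorm_three_le_iff]
      -- Resampling coordinate `i` from its own law leaves the product measure unchanged.
      have hmp := measurePreserving_update lam i (lam i)
      rw [Function.update_eq_self] at hmp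
      have hfm : Measurable fun x : Fin n → E =>
          ‖∑ σ ∈ Fintype.piFinset t, c σ * prodFun u σ x‖ₑ ^ 3 :=
        (Finset.measurable_fun_sum _ fun σ _ =>
          (measurable_prodFun hu σ).const_mul _).enorm.pow_const 3
      rw [← hmp.lintegral_comp hfm, lintegral_prod (fun p : (Fin n → E) × E =>
        ‖∑ σ ∈ Fintype.piFinset t, c σ * prodFun u σ (Function.update p.1 i p.2)‖ₑ ^ 3)
        (hfm.comp hmp.measurable).aemeasurable]
      refine lintegral_mono fun w => ?_
      simp only [sum_prodFun_update hu0 t c i w, hti]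
      refine (lintegral_enorm_pow_three_le (h1 i fun j => G j w)).trans (le_of_eq ?_)
      rw [Real.enorm_eq_ofReal (Real.sqrt_nonneg _)]
    refine step.trans ?_
    rw [sum_piFinset_eq_sum_update t i, hti]
    refine eLpNorm_sqrt_sum_sq_le _ (fun j _ => (hGm j).aestronglyMeasurable) (fun j _ => ?_)
      fun j _ => Finset.sum_nonneg fun σ _ => sq_nonneg _
    simp only [hGdef, htu]
    exact ih _

/-! ### Taylor expansion to second order -/

/-- The mean value inequality is applied three times on `[0, 1]`. This gives the constant `C`
instead of the sharp `C / 6`, which is enough here. -/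
theorem abs_sub_taylor_two_le {g₀ g₁ g₂ g₃ : ℝ → ℝ} (h₀ : ∀ t, HasDerivAt g₀ (g₁ t) t)
    (h₁ : ∀ t, HasDerivAt g₁ (g₂ t) t) (h₂ : ∀ t, HasDerivAt g₂ (g₃ t) t) {C : ℝ}
    (h₃ : ∀ t, |g₃ t| ≤ C) : |g₀ 1 - (g₀ 0 + g₁ 0 + 1 / 2 * g₂ 0)| ≤ C := by
  have hC : 0 ≤ C := (abs_nonneg _).trans (h₃ 0)
  have aux : ∀ {f f' : ℝ → ℝ}, (∀ t, HasDerivAt f (f' t) t) →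
      (∀ t ∈ Set.Icc (0 : ℝ) 1, |f' t| ≤ C) → ∀ t ∈ Set.Icc (0 : ℝ) 1, |f t - f 0| ≤ C := by
    intro f f' hf hf' t ht
    have := norm_image_sub_le_of_norm_deriv_le_segment' (f := f) (f' := f') (C := C) (a := 0)
      (b := 1) (fun x _ => (hf x).hasDerivWithinAt)
      (fun x hx => hf' x (Set.Ico_subset_Icc_self hx)) t ht
    rw [Real.norm_eq_abs] at this
    nlinarith [ht.1, ht.2]
  have b2 := aux h₂ fun t _ => h₃ t
  have b1 := aux (f := fun t => g₁ t - t * g₂ 0) (f' := fun t => g₂ t - g₂ 0)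
    (fun t => ((h₁ t).sub ((hasDerivAt_id t).mul_const (g₂ 0))).congr_deriv (by simp)) b2
  have b0 := aux (f := fun t => g₀ t - t * g₁ 0 - t ^ 2 / 2 * g₂ 0)
    (f' := fun t => g₁ t - g₁ 0 - t * g₂ 0)
    (fun t => by
      have h := ((h₀ t).sub ((hasDerivAt_id t).mul_const (g₁ 0))).sub
        ((((hasDerivAt_id t).pow 2).div_const 2).mul_const (g₂ 0))
      refine h.congr_deriv ?_
      simp)
    (fun t ht => by
      have := b1 t ht
      convert this using 2
      ring)
  have := b0 1 (by simp)
  convert this using 2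
  ring

theorem hasDerivAt_lineMap_partialDeriv {k : ℕ} {f : (Fin k → ℝ) → ℝ} (hf : Differentiable ℝ f)
    (x h : Fin k → ℝ) (t : ℝ) :
    HasDerivAt (fun t : ℝ => f (x + t • h)) (∑ a, h a * partialDeriv a f (x + t • h)) t := by
  have h1 : HasDerivAt (fun t : ℝ => x + t • h) h t := by
    simpa using ((hasDerivAt_id t).smul_const h).const_add x
  refine ((hf (x + t • h)).hasFDerivAt.comp_hasDerivAt t h1).congr_deriv ?_
  unfold partialDeriv
  generalize fderiv ℝ f (x + t • h) = L
  conv_lhs => rw [← Finset.univ_sum_single h]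
  rw [map_sum]
  refine Finset.sum_congr rfl fun a _ => ?_
  rw [← smul_eq_mul, ← map_smul, ← Pi.single_smul, smul_eq_mul, mul_one]

theorem contDiff_partialDeriv {k : ℕ} {f : (Fin k → ℝ) → ℝ} {p q : WithTop ℕ∞}
    (hf : ContDiff ℝ p f) (hpq : q + 1 ≤ p) (a : Fin k) : ContDiff ℝ q (partialDeriv a f) :=
  (hf.fderiv_right hpq).clm_apply contDiff_const

/-- The second order Taylor polynomial of `Ψ` at `x`. -/
def taylorTwo {k : ℕ} (Ψ : (Fin k → ℝ) → ℝ) (x h : Fin k → ℝ) : ℝ :=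
  Ψ x + ∑ a, h a * partialDeriv a Ψ x +
    1 / 2 * ∑ a, ∑ b, h a * h b * partialDeriv b (partialDeriv a Ψ) x

/-- Along the segment from `x` to `x + h` the third derivative of `Ψ` is a triple sum of third
partials weighted by products of three entries of `h`. -/
theorem abs_sub_taylorTwo_le {k : ℕ} {B : ℝ} {Ψ : (Fin k → ℝ) → ℝ} (hΨ : ContDiff ℝ 3 Ψ)
    (hB : ∀ (a₁ a₂ a₃ : Fin k) (x : Fin k → ℝ),
      |partialDeriv a₁ (partialDeriv a₂ (partialDeriv a₃ Ψ)) x| ≤ B) (x h : Fin k → ℝ) :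
    |Ψ (x + h) - taylorTwo Ψ x h| ≤ B * (∑ a, |h a|) ^ 3 := by
  have d0 : Differentiable ℝ Ψ := hΨ.differentiable (by norm_num)
  have c1 : ∀ a, ContDiff ℝ 2 (partialDeriv a Ψ) := fun a =>
    contDiff_partialDeriv hΨ (by norm_num) a
  have c2 : ∀ a b, ContDiff ℝ 1 (partialDeriv b (partialDeriv a Ψ)) := fun a b =>
    contDiff_partialDeriv (c1 a) (by norm_num) b
  have key := abs_sub_taylor_two_le (C := B * (∑ a, |h a|) ^ 3)
    (g₀ := fun t : ℝ => Ψ (x + t • h))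
    (g₁ := fun t => ∑ a, h a * partialDeriv a Ψ (x + t • h))
    (g₂ := fun t => ∑ a, h a * ∑ b, h b * partialDeriv b (partialDeriv a Ψ) (x + t • h))
    (g₃ := fun t => ∑ a, h a * ∑ b, h b *
      ∑ c, h c * partialDeriv c (partialDeriv b (partialDeriv a Ψ)) (x + t • h))
    (fun t => hasDerivAt_lineMap_partialDeriv d0 x h t)
    (fun t => HasDerivAt.fun_sum fun a _ => (hasDerivAt_lineMap_partialDeriv
      ((c1 a).differentiable (by norm_num)) x h t).const_mul _)
    (fun t => HasDerivAt.fun_sum fun a _ => (HasDerivAt.fun_sum fun b _ =>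
      (hasDerivAt_lineMap_partialDeriv ((c2 a b).differentiable (by norm_num)) x h t).const_mul
        _).const_mul _)
    (fun t => by
      have e : B * (∑ a, |h a|) ^ 3 = ∑ a, |h a| * ∑ b, |h b| * ∑ c, |h c| * B := by
        simp only [← Finset.sum_mul]
        ring
      rw [e]
      refine (Finset.abs_sum_le_sum_abs _ _).trans (Finset.sum_le_sum fun a _ => ?_)
      rw [abs_mul]
      gcongr
      refine (Finset.abs_sum_le_sum_abs _ _).trans (Finset.sum_le_sum fun b _ => ?_)
      rw [abs_mul]
      gcongr
      refine (Finset.abs_sum_le_sum_abs _ _).trans (Finset.sum_le_sum fun c _ => ?_)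
      rw [abs_mul]
      gcongr
      exact hB _ _ _ _)
  convert key using 2
  simp [taylorTwo, Finset.mul_sum, mul_assoc]

section Integrability

variable {k : ℕ} {B : ℝ} {Ψ : (Fin k → ℝ) → ℝ} {Ω : Type*} [MeasurableSpace Ω] {μ : Measure Ω}

theorem integrable_taylorTwo [IsFiniteMeasure μ] (x : Fin k → ℝ) {H : Ω → Fin k → ℝ}
    (hH : ∀ a, MemLp (fun ω => H ω a) 3 μ) :
    Integrable (fun ω => taylorTwo Ψ x (H ω)) μ := by
  have h2 : ∀ a, MemLp (fun ω => H ω a) 2 μ := fun a => (hH a).mono_exponent (by norm_num)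
  unfold taylorTwo
  refine ((integrable_const _).add (integrable_finsetSum _ fun a _ => ?_)).add
    (Integrable.const_mul (integrable_finsetSum _ fun a _ => integrable_finsetSum _ fun b _ => ?_)
      _)
  · exact ((hH a).integrable (by norm_num)).mul_const _
  · exact ((h2 a).integrable_mul (h2 b)).mul_const _

theorem integrable_sum_abs_pow_three {H : Ω → Fin k → ℝ}
    (hH : ∀ a, MemLp (fun ω => H ω a) 3 μ) :
    Integrable (fun ω => (∑ a, |H ω a|) ^ 3) μ := by
  have : MemLp (fun ω => ∑ a, |H ω a|) 3 μ := memLp_finsetSum _ fun a _ => (hH a).abs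
  refine (this.integrable_norm_pow (p := 3) (by norm_num)).congr (.of_forall fun ω => ?_)
  simp only [Real.norm_eq_abs]
  rw [abs_of_nonneg (Finset.sum_nonneg fun a _ => abs_nonneg _)]

/-- The Taylor polynomial is quadratic and the remainder is at most cubic in the increment, so third
moments suffice. -/
theorem integrable_comp_add [IsFiniteMeasure μ] (hΨ : ContDiff ℝ 3 Ψ)
    (hB : ∀ (a₁ a₂ a₃ : Fin k) (x : Fin k → ℝ),
      |partialDeriv a₁ (partialDeriv a₂ (partialDeriv a₃ Ψ)) x| ≤ B)
    (x : Fin k → ℝ) {H : Ω → Fin k → ℝ} (hH : ∀ a, MemLp (fun ω => H ω a) 3 μ) :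
    Integrable (fun ω => Ψ (x + H ω)) μ := by
  have h1 := integrable_taylorTwo (Ψ := Ψ) x hH
  have hm : AEStronglyMeasurable (fun ω => Ψ (x + H ω)) μ := by
    refine hΨ.continuous.comp_aestronglyMeasurable (aestronglyMeasurable_const.add ?_)
    exact (aemeasurable_pi_lambda _ fun a => (hH a).aestronglyMeasurable.aemeasurable).aestronglyMeasurable
  have h2 : Integrable (fun ω => Ψ (x + H ω) - taylorTwo Ψ x (H ω)) μ :=
    Integrable.mono' ((integrable_sum_abs_pow_three hH).const_mul B)
      (hm.sub h1.aestronglyMeasurable) (.of_forall fun ω => abs_sub_taylorTwo_le hΨ hB x (H ω))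
  refine (h2.add h1).congr (.of_forall fun ω => ?_)
  simp

end Integrability

/-! ### Replacing one ensemble while the others are fixed -/

/-- The functions `e 0 = 1, …, e M` are orthonormal with respect to `κ`, and `(2, 3, η)`
hypercontractive. -/
structure IsHyperBlock {E : Type*} [MeasurableSpace E] (e : ℕ → E → ℝ) (η : ℝ) (M : ℕ)
    (κ : Measure E) : Prop where
  orthonormal : ∀ j ≤ M, ∀ j' ≤ M, ∫ z, e j z * e j' z ∂κ = if j = j' then 1 else 0
  hyper : ∀ c : ℕ → ℝ,
    eLpNorm (fun z => ∑ j ∈ Finset.range (M + 1), c j * ((if 0 < j then η else 1) * e j z)) 3 κ ≤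
      ENNReal.ofReal (√(∑ j ∈ Finset.range (M + 1), c j ^ 2))

section Block

variable {E : Type*} [MeasurableSpace E] {e : ℕ → E → ℝ} {η : ℝ} {M : ℕ} {κ : Measure E}

theorem IsHyperBlock.memLp (h : IsHyperBlock e η M κ) (he : ∀ j, Measurable (e j)) (hη : 0 < η)
    {j : ℕ} (hj : j ≤ M) : MemLp (e j) 3 κ := by
  have h1 : MemLp (fun z => (if 0 < j then η else 1) * e j z) 3 κ := by
    refine ⟨((he j).const_mul _).aestronglyMeasurable, ?_⟩
    -- The coefficient family `Pi.single j 1` isolates `e j`; the finite right-hand side of `hyper`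
    -- then supplies the third moment.
    refine lt_of_eq_of_lt ?_ ((h.hyper (Pi.single j 1)).trans_lt ENNReal.ofReal_lt_top)
    congr 1
    ext z
    rw [Finset.sum_eq_single_of_mem j (Finset.mem_range.2 (Nat.lt_succ_of_le hj))]
    · simp
    · intro l _ hl
      simp [hl]
  have hne : (if 0 < j then η else 1) ≠ 0 := by split_ifs <;> [exact hη.ne'; exact one_ne_zero]
  refine (h1.const_mul (if 0 < j then η else 1)⁻¹).ae_eq (.of_forall fun z => ?_)
  simp only [← mul_assoc, inv_mul_cancel₀ hne, one_mul]

variable [IsProbabilityMeasure κ] {k : ℕ} {B : ℝ} {Ψ : (Fin k → ℝ) → ℝ}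

/-- This is the matching of moments: orthogonality to `e 0 = 1` kills the linear term, and
orthonormality evaluates the quadratic one. The resulting value does not depend on `κ`. -/
theorem IsHyperBlock.integral_taylorTwo (h : IsHyperBlock e η M κ) (he : ∀ j, Measurable (e j))
    (he0 : ∀ z, e 0 z = 1) (hη : 0 < η) (x : Fin k → ℝ) (A : Fin k → ℕ → ℝ) :
    ∫ z, taylorTwo Ψ x (fun a => ∑ j ∈ Finset.range M, A a (j + 1) * e (j + 1) z) ∂κ =
      Ψ x + 1 / 2 * ∑ a, ∑ b, (∑ j ∈ Finset.range M, A a (j + 1) * A b (j + 1)) *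
        partialDeriv b (partialDeriv a Ψ) x := by
  have hL : ∀ j ∈ Finset.range M, MemLp (e (j + 1)) 3 κ := fun j hj =>
    h.memLp he hη (Finset.mem_range.1 hj)
  have hS : ∀ a, MemLp (fun z => ∑ j ∈ Finset.range M, A a (j + 1) * e (j + 1) z) 3 κ :=
    fun a => memLp_finsetSum _ fun j hj => (hL j hj).const_mul _
  have hS2 : ∀ a, MemLp (fun z => ∑ j ∈ Finset.range M, A a (j + 1) * e (j + 1) z) 2 κ :=
    fun a => (hS a).mono_exponent (by norm_num)
  have hL2 : ∀ j ∈ Finset.range M, MemLp (e (j + 1)) 2 κ := fun j hj =>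
    (hL j hj).mono_exponent (by norm_num)
  have m1 : ∀ a, ∫ z, ∑ j ∈ Finset.range M, A a (j + 1) * e (j + 1) z ∂κ = 0 := by
    intro a
    rw [integral_finsetSum _ fun j hj => ((hL j hj).integrable (by norm_num)).const_mul _]
    refine Finset.sum_eq_zero fun j hj => ?_
    have := h.orthonormal (j + 1) (Finset.mem_range.1 hj) 0 (Nat.zero_le _)
    simp only [he0, mul_one, Nat.succ_ne_zero, if_false] at this
    rw [integral_const_mul, this, mul_zero]
  have m2 : ∀ a b, ∫ z, (∑ j ∈ Finset.range M, A a (j + 1) * e (j + 1) z) *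
      (∑ j ∈ Finset.range M, A b (j + 1) * e (j + 1) z) ∂κ =
      ∑ j ∈ Finset.range M, A a (j + 1) * A b (j + 1) := by
    intro a b
    have hi : ∀ j ∈ Finset.range M, ∀ j' ∈ Finset.range M,
        Integrable (fun z => A a (j + 1) * A b (j' + 1) * (e (j + 1) z * e (j' + 1) z)) κ :=
      fun j hj j' hj' => ((hL2 j hj).integrable_mul (hL2 j' hj')).const_mul _
    have e1 : ∀ z, (∑ j ∈ Finset.range M, A a (j + 1) * e (j + 1) z) *
        (∑ j ∈ Finset.range M, A b (j + 1) * e (j + 1) z) = ∑ j ∈ Finset.range M,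
          ∑ j' ∈ Finset.range M, A a (j + 1) * A b (j' + 1) * (e (j + 1) z * e (j' + 1) z) := by
      intro z
      rw [Finset.sum_mul_sum]
      exact Finset.sum_congr rfl fun j _ => Finset.sum_congr rfl fun j' _ => by ring
    simp only [e1]
    rw [integral_finsetSum _ fun j hj => integrable_finsetSum _ fun j' hj' => hi j hj j' hj']
    refine Finset.sum_congr rfl fun j hj => ?_
    rw [integral_finsetSum _ fun j' hj' => hi j hj j' hj']
    rw [Finset.sum_eq_single_of_mem j hj]
    · rw [integral_const_mul, h.orthonormal _ (Finset.mem_range.1 hj) _ (Finset.mem_range.1 hj)]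
      simp
    · intro j' hj' hne
      rw [integral_const_mul, h.orthonormal _ (Finset.mem_range.1 hj) _ (Finset.mem_range.1 hj'),
        if_neg (by omega), mul_zero]
  simp only [taylorTwo]
  have i1 : ∀ a, Integrable (fun z => (∑ j ∈ Finset.range M, A a (j + 1) * e (j + 1) z) *
      partialDeriv a Ψ x) κ := fun a => ((hS a).integrable (by norm_num)).mul_const _
  have i2 : ∀ a b, Integrable (fun z => (∑ j ∈ Finset.range M, A a (j + 1) * e (j + 1) z) *
      (∑ j ∈ Finset.range M, A b (j + 1) * e (j + 1) z) *
      partialDeriv b (partialDeriv a Ψ) x) κ := fun a b =>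
    ((hS2 a).integrable_mul (hS2 b)).mul_const _
  rw [integral_add (f := fun z => Ψ x + ∑ a, (∑ j ∈ Finset.range M, A a (j + 1) * e (j + 1) z) *
        partialDeriv a Ψ x)
      ((integrable_const _).add (integrable_finsetSum _ fun a _ => i1 a))
      ((integrable_finsetSum _ fun a _ => integrable_finsetSum _ fun b _ => i2 a b).const_mul _),
    integral_add (integrable_const _) (integrable_finsetSum _ fun a _ => i1 a),
    integral_finsetSum _ fun a _ => i1 a, integral_const_mul,
    integral_finsetSum _ fun a _ => integrable_finsetSum _ fun b _ => i2 a b]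
  simp only [integral_finsetSum _ fun b _ => i2 _ b, integral_mul_const, m1, m2]
  simp

theorem IsHyperBlock.abs_integral_sub_le (h : IsHyperBlock e η M κ) (he : ∀ j, Measurable (e j))
    (he0 : ∀ z, e 0 z = 1) (hη : 0 < η) (hΨ : ContDiff ℝ 3 Ψ)
    (hB : ∀ (a₁ a₂ a₃ : Fin k) (x : Fin k → ℝ),
      |partialDeriv a₁ (partialDeriv a₂ (partialDeriv a₃ Ψ)) x| ≤ B) (A : Fin k → ℕ → ℝ) :
    |(∫ z, Ψ (fun a => ∑ j ∈ Finset.range (M + 1), A a j * e j z) ∂κ) -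
      (Ψ (fun a => A a 0) + 1 / 2 * ∑ a, ∑ b, (∑ j ∈ Finset.range M, A a (j + 1) * A b (j + 1)) *
        partialDeriv b (partialDeriv a Ψ) fun a => A a 0)| ≤
      B * ∫ z, (∑ a, |∑ j ∈ Finset.range M, A a (j + 1) * e (j + 1) z|) ^ 3 ∂κ := by
  have hS : ∀ a, MemLp (fun z => ∑ j ∈ Finset.range M, A a (j + 1) * e (j + 1) z) 3 κ :=
    fun a => memLp_finsetSum _ fun j hj => (h.memLp he hη (Finset.mem_range.1 hj)).const_mul _
  have e1 : ∀ z, (fun a => ∑ j ∈ Finset.range (M + 1), A a j * e j z) =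
      (fun a => A a 0) + fun a => ∑ j ∈ Finset.range M, A a (j + 1) * e (j + 1) z := by
    intro z
    ext a
    rw [Finset.sum_range_succ', he0, mul_one, add_comm, Pi.add_apply]
  simp only [e1]
  rw [← h.integral_taylorTwo he he0 hη, ← integral_sub (integrable_comp_add hΨ hB _ hS)
    (integrable_taylorTwo _ hS), ← integral_const_mul]
  refine (abs_integral_le_integral_abs).trans (integral_mono ?_ ?_ fun z => ?_)
  · exact ((integrable_comp_add hΨ hB _ hS).sub (integrable_taylorTwo _ hS)).abs
  · exact (integrable_sum_abs_pow_three hS).const_mul _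
  · exact abs_sub_taylorTwo_le hΨ hB _ _

end Block

/-! ### The replacement argument for product measures -/

theorem prod_ite_pos_eq_pow_multiDegree {n : ℕ} (η : ℝ) (σ : Fin n → ℕ) :
    ∏ l, (if 0 < σ l then η else 1) = η ^ multiDegree σ := by
  rw [Finset.prod_ite, Finset.prod_const, Finset.prod_const_one, mul_one, multiDegree]

section Product

variable {n : ℕ} {E : Type*} [MeasurableSpace E] {e : ℕ → E → ℝ} {η : ℝ} {M : Fin n → ℕ}

/-- The multi-indices `σ` with `σ i ≤ M i` for all `i`. -/
def indexBox (M : Fin n → ℕ) : Finset (Fin n → ℕ) :=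
  Fintype.piFinset fun i => Finset.range (M i + 1)

theorem mem_indexBox {σ : Fin n → ℕ} : σ ∈ indexBox M ↔ ∀ i, σ i ≤ M i := by
  simp [indexBox]

/-- The multilinear polynomial with coefficients `c` on the box `indexBox M`, evaluated at the
functions `e 0, e 1, …` of each coordinate. -/
def boxPoly (e : ℕ → E → ℝ) (M : Fin n → ℕ) (c : (Fin n → ℕ) → ℝ) (x : Fin n → E) : ℝ :=
  ∑ σ ∈ indexBox M, c σ * prodFun e σ x

theorem measurable_boxPoly (he : ∀ j, Measurable (e j)) (c : (Fin n → ℕ) → ℝ) :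
    Measurable (boxPoly e M c) :=
  Finset.measurable_fun_sum _ fun σ _ => (measurable_prodFun he σ).const_mul _

variable (lam : Fin n → Measure E) [∀ i, IsProbabilityMeasure (lam i)]

/-- Hypercontractivity of product measures: the `L³` norm of a polynomial of degree at most `d` is
controlled by its `L²` norm. -/
theorem eLpNorm_boxPoly_le (he : ∀ j, Measurable (e j)) (he0 : ∀ z, e 0 z = 1) (hη : 0 < η)
    (hη1 : η ≤ 1) (h : ∀ i, IsHyperBlock e η (M i) (lam i)) {c : (Fin n → ℕ) → ℝ} {d : ℕ}
    (hd : ∀ σ ∈ indexBox M, c σ ≠ 0 → multiDegree σ ≤ d) :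
    eLpNorm (boxPoly e M c) 3 (Measure.pi lam) ≤
      ENNReal.ofReal ((η⁻¹) ^ d * √(∑ σ ∈ indexBox M, c σ ^ 2)) := by
  have key := eLpNorm_sum_prodFun_le (u := fun j z => (if 0 < j then η else 1) * e j z)
    (fun j => (he j).const_mul _) (fun z => by simp [he0]) lam (fun i => Finset.range (M i + 1))
    -- The coefficients are multiplied in advance by `(η⁻¹) ^ |σ|` to undo the noise; since `η ≤ 1`,
    -- this costs at most `(η⁻¹) ^ d`.
    (fun i c => (h i).hyper c) Finset.univ (fun σ => (η⁻¹) ^ multiDegree σ * c σ)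
  simp only [Finset.mem_univ, if_true] at key
  have e1 : ∀ (σ : Fin n → ℕ) (x : Fin n → E),
      (η⁻¹) ^ multiDegree σ * c σ * prodFun (fun j z => (if 0 < j then η else 1) * e j z) σ x =
      c σ * prodFun e σ x := by
    intro σ x
    simp only [prodFun, Finset.prod_mul_distrib, prod_ite_pos_eq_pow_multiDegree]
    rw [mul_comm (_ ^ _) (c σ), mul_assoc, ← mul_assoc (_ ^ _), ← mul_pow,
      inv_mul_cancel₀ hη.ne', one_pow, one_mul]
  simp only [e1] at key
  refine key.trans (ENNReal.ofReal_le_ofReal ?_)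
  have h1 : 1 ≤ η⁻¹ := (one_le_inv₀ hη).2 hη1
  rw [← Real.sqrt_sq (by positivity : 0 ≤ (η⁻¹) ^ d), ← Real.sqrt_mul (by positivity)]
  refine Real.sqrt_le_sqrt ?_
  rw [Finset.mul_sum]
  refine Finset.sum_le_sum fun σ hσ => ?_
  rw [mul_pow]
  by_cases hc : c σ = 0
  · simp [hc]
  · gcongr
    exact hd σ hσ hc

theorem memLp_boxPoly (he : ∀ j, Measurable (e j)) (he0 : ∀ z, e 0 z = 1) (hη : 0 < η)
    (hη1 : η ≤ 1) (h : ∀ i, IsHyperBlock e η (M i) (lam i)) (c : (Fin n → ℕ) → ℝ) :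
    MemLp (boxPoly e M c) 3 (Measure.pi lam) :=
  ⟨(measurable_boxPoly he c).aestronglyMeasurable,
    -- Every multi-index has degree at most `n`, so finiteness needs no degree assumption.
    (eLpNorm_boxPoly_le lam he he0 hη hη1 h (d := n) fun _ _ _ =>
      (Finset.card_le_univ _).trans_eq (Fintype.card_fin n)).trans_lt ENNReal.ofReal_lt_top⟩

theorem integral_abs_boxPoly_pow_three_le (he : ∀ j, Measurable (e j)) (he0 : ∀ z, e 0 z = 1)
    (hη : 0 < η) (hη1 : η ≤ 1) (h : ∀ i, IsHyperBlock e η (M i) (lam i))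
    {c : (Fin n → ℕ) → ℝ} {d : ℕ} (hd : ∀ σ ∈ indexBox M, c σ ≠ 0 → multiDegree σ ≤ d) :
    ∫ x, |boxPoly e M c x| ^ 3 ∂Measure.pi lam ≤
      ((η⁻¹) ^ d * √(∑ σ ∈ indexBox M, c σ ^ 2)) ^ 3 := by
  have h1 := lintegral_enorm_pow_three_le (eLpNorm_boxPoly_le lam he he0 hη hη1 h hd)
  rw [← ENNReal.ofReal_pow (by positivity)] at h1
  rw [integral_eq_lintegral_of_nonneg_ae (.of_forall fun x => by positivity)
    ((measurable_boxPoly he c).abs.pow_const 3).aestronglyMeasurable]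
  refine ENNReal.toReal_le_of_le_ofReal (by positivity) (le_trans (le_of_eq ?_) h1)
  refine lintegral_congr fun x => ?_
  rw [Real.enorm_eq_ofReal_abs, ENNReal.ofReal_pow (abs_nonneg _)]

theorem sum_abs_pow_three_le {k : ℕ} (f : Fin k → ℝ) :
    (∑ a, |f a|) ^ 3 ≤ (k : ℝ) ^ 2 * ∑ a, |f a| ^ 3 := by
  rcases Nat.eq_zero_or_pos k with rfl | hk
  · simp
  · have := pow_sum_div_card_le_sum_pow (s := Finset.univ) (f := fun a => |f a|)
      (fun a _ => abs_nonneg _) 2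
    rw [Finset.card_univ, Fintype.card_fin, div_le_iff₀ (by positivity), mul_comm] at this
    exact this

theorem integral_sum_abs_boxPoly_pow_three_le (he : ∀ j, Measurable (e j))
    (he0 : ∀ z, e 0 z = 1) (hη : 0 < η) (hη1 : η ≤ 1)
    (h : ∀ i, IsHyperBlock e η (M i) (lam i)) {k : ℕ} {c : Fin k → (Fin n → ℕ) → ℝ} {d : ℕ}
    (hd : ∀ a, ∀ σ ∈ indexBox M, c a σ ≠ 0 → multiDegree σ ≤ d) :
    ∫ x, (∑ a, |boxPoly e M (c a) x|) ^ 3 ∂Measure.pi lam ≤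
      (k : ℝ) ^ 2 * ∑ a, ((η⁻¹) ^ d * √(∑ σ ∈ indexBox M, c a σ ^ 2)) ^ 3 := by
  have hL := fun a => memLp_boxPoly lam he he0 hη hη1 h (c a)
  have hi : ∀ a, Integrable (fun x => |boxPoly e M (c a) x| ^ 3) (Measure.pi lam) := fun a => by
    simpa using (hL a).integrable_norm_pow (p := 3) (by norm_num)
  calc _ ≤ ∫ x, (k : ℝ) ^ 2 * ∑ a, |boxPoly e M (c a) x| ^ 3 ∂Measure.pi lam :=
        integral_mono (integrable_sum_abs_pow_three hL)
          ((integrable_finsetSum _ fun a _ => hi a).const_mul _) fun x => sum_abs_pow_three_le _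
    _ = (k : ℝ) ^ 2 * ∑ a, ∫ x, |boxPoly e M (c a) x| ^ 3 ∂Measure.pi lam := by
        rw [integral_const_mul, integral_finsetSum _ fun a _ => hi a]
    _ ≤ _ := by
        gcongr with a
        exact integral_abs_boxPoly_pow_three_le lam he he0 hη hη1 h (hd a)

variable {k : ℕ} {B : ℝ} {Ψ : (Fin k → ℝ) → ℝ}

/-- The coefficients of the part of a polynomial that depends on the `i`-th coordinate. -/
def activeCoeff (i : Fin n) (c : (Fin n → ℕ) → ℝ) (σ : Fin n → ℕ) : ℝ :=
  if σ i = 0 then 0 else c σ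

theorem boxPoly_update {E : Type*} {e : ℕ → E → ℝ}
    (he0 : ∀ z, e 0 z = 1) (c : (Fin n → ℕ) → ℝ) (i : Fin n) (w : Fin n → E)
    (z : E) :
    boxPoly e M c (Function.update w i z) = ∑ j ∈ Finset.range (M i + 1),
      (∑ σ ∈ Fintype.piFinset (Function.update (fun i => Finset.range (M i + 1)) i {0}),
        c (Function.update σ i j) * prodFun e σ w) * e j z :=
  sum_prodFun_update he0 _ c i w z

/-- The active part is the block expansion without its `j = 0` term, hence exactly the Taylor
increment. -/
theorem boxPoly_activeCoeff_update {E : Type*} {e : ℕ → E → ℝ}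
    (he0 : ∀ z, e 0 z = 1) (c : (Fin n → ℕ) → ℝ) (i : Fin n)
    (w : Fin n → E) (z : E) :
    boxPoly e M (activeCoeff i c) (Function.update w i z) = ∑ j ∈ Finset.range (M i),
      (∑ σ ∈ Fintype.piFinset (Function.update (fun i => Finset.range (M i + 1)) i {0}),
        c (Function.update σ i (j + 1)) * prodFun e σ w) * e (j + 1) z := by
  rw [boxPoly_update he0, Finset.sum_range_succ']
  simp [activeCoeff]

theorem isHyperBlock_update {lam : Fin n → Measure E} (h : ∀ i, IsHyperBlock e η (M i) (lam i))
    {i : Fin n} {κ : Measure E} (hκ : IsHyperBlock e η (M i) κ) (l : Fin n) :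
    IsHyperBlock e η (M l) (Function.update lam i κ l) := by
  by_cases hl : l = i
  · subst hl; simpa
  · simpa [Function.update_of_ne hl] using h l

/-- One replacement step. The factor `lam i` is integrated out, so both integrals become averages
over the same `w`. The factor `2` counts the Taylor errors under `κ` and `κ'`. -/
theorem abs_integral_update_sub_le (he : ∀ j, Measurable (e j)) (he0 : ∀ z, e 0 z = 1)
    (hη : 0 < η) (hη1 : η ≤ 1) (h : ∀ i, IsHyperBlock e η (M i) (lam i))
    (hΨ : ContDiff ℝ 3 Ψ)
    (hB : ∀ (a₁ a₂ a₃ : Fin k) (x : Fin k → ℝ),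
      |partialDeriv a₁ (partialDeriv a₂ (partialDeriv a₃ Ψ)) x| ≤ B) (hB0 : 0 ≤ B)
    {c : Fin k → (Fin n → ℕ) → ℝ} {d : ℕ}
    (hd : ∀ a, ∀ σ ∈ indexBox M, c a σ ≠ 0 → multiDegree σ ≤ d)
    (i : Fin n) (κ κ' : Measure E) [IsProbabilityMeasure κ] [IsProbabilityMeasure κ']
    (hκ : IsHyperBlock e η (M i) κ) (hκ' : IsHyperBlock e η (M i) κ') :
    |(∫ x, Ψ (fun a => boxPoly e M (c a) x) ∂Measure.pi (Function.update lam i κ)) -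
      ∫ x, Ψ (fun a => boxPoly e M (c a) x) ∂Measure.pi (Function.update lam i κ')| ≤
      2 * B * ((k : ℝ) ^ 2 *
        ∑ a, ((η⁻¹) ^ d * √(∑ σ ∈ indexBox M, activeCoeff i (c a) σ ^ 2)) ^ 3) := by
  set R := (k : ℝ) ^ 2 *
        ∑ a, ((η⁻¹) ^ d * √(∑ σ ∈ indexBox M, activeCoeff i (c a) σ ^ 2)) ^ 3 with hR
  have hd' : ∀ a, ∀ σ ∈ indexBox M, activeCoeff i (c a) σ ≠ 0 → multiDegree σ ≤ d := by
    intro a σ hσ h0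
    refine hd a σ hσ fun h1 => h0 ?_
    simp [activeCoeff, h1]
  have main : ∀ κ : Measure E, IsProbabilityMeasure κ → IsHyperBlock e η (M i) κ →
      (∫ x, Ψ (fun a => boxPoly e M (c a) x) ∂Measure.pi (Function.update lam i κ) =
        ∫ w, ∫ z, Ψ (fun a => boxPoly e M (c a) (Function.update w i z)) ∂κ ∂Measure.pi lam) ∧
      Integrable (fun w => ∫ z, Ψ (fun a => boxPoly e M (c a) (Function.update w i z)) ∂κ)
        (Measure.pi lam) ∧
      Integrable (fun w => ∫ z, (∑ a, |boxPoly e M (activeCoeff i (c a))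
        (Function.update w i z)|) ^ 3 ∂κ) (Measure.pi lam) ∧
      ∫ w, ∫ z, (∑ a, |boxPoly e M (activeCoeff i (c a))
        (Function.update w i z)|) ^ 3 ∂κ ∂Measure.pi lam ≤ R := by
    intro κ _ hκ
    have hmp := measurePreserving_update lam i κ
    have := isProbabilityMeasure_update lam i κ
    have hu := isHyperBlock_update h hκ
    have hL := fun a => memLp_boxPoly _ he he0 hη hη1 hu (c a)
    have hL' := fun a => memLp_boxPoly _ he he0 hη hη1 hu (activeCoeff i (c a))
    have i1 : Integrable (fun x => Ψ (fun a => boxPoly e M (c a) x))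
        (Measure.pi (Function.update lam i κ)) := by
      simpa using integrable_comp_add hΨ hB 0 hL
    have i2 := integrable_sum_abs_pow_three hL'
    have j1 := hmp.integrable_comp_of_integrable i1
    have j2 := hmp.integrable_comp_of_integrable i2
    refine ⟨?_, j1.integral_prod_left, j2.integral_prod_left, ?_⟩
    · rw [← hmp.map_eq, integral_map hmp.measurable.aemeasurable
        (by rw [hmp.map_eq]; exact i1.aestronglyMeasurable)]
      exact integral_prod _ j1
    · refine le_trans (le_of_eq ?_)
        (integral_sum_abs_boxPoly_pow_three_le _ he he0 hη hη1 hu hd')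
      rw [← hmp.map_eq, integral_map hmp.measurable.aemeasurable
        (by rw [hmp.map_eq]; exact i2.aestronglyMeasurable)]
      exact (integral_prod _ j2).symm
  obtain ⟨a1, a2, a3, a4⟩ := main κ ‹_› hκ
  obtain ⟨b1, b2, b3, b4⟩ := main κ' ‹_› hκ'
  rw [a1, b1, ← integral_sub a2 b2]
  -- For fixed `w`, both inner integrals are compared with the same second-order value.
  have pt : ∀ w, |(∫ z, Ψ (fun a => boxPoly e M (c a) (Function.update w i z)) ∂κ) -
      ∫ z, Ψ (fun a => boxPoly e M (c a) (Function.update w i z)) ∂κ'| ≤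
      B * ∫ z, (∑ a, |boxPoly e M (activeCoeff i (c a)) (Function.update w i z)|) ^ 3 ∂κ +
      B * ∫ z, (∑ a, |boxPoly e M (activeCoeff i (c a)) (Function.update w i z)|) ^ 3 ∂κ' := by
    intro w
    simp only [boxPoly_activeCoeff_update he0]
    simp only [boxPoly_update he0]
    have h1 := hκ.abs_integral_sub_le he he0 hη hΨ hB fun a j =>
      ∑ σ ∈ Fintype.piFinset (Function.update (fun i => Finset.range (M i + 1)) i {0}),
        c a (Function.update σ i j) * prodFun e σ w
    have h2 := hκ'.abs_integral_sub_le he he0 hη hΨ hB fun a j =>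
      ∑ σ ∈ Fintype.piFinset (Function.update (fun i => Finset.range (M i + 1)) i {0}),
        c a (Function.update σ i j) * prodFun e σ w
    rw [abs_sub_comm] at h2
    exact (abs_sub_le _ _ _).trans (add_le_add h1 h2)
  calc _ ≤ ∫ w, |(∫ z, Ψ (fun a => boxPoly e M (c a) (Function.update w i z)) ∂κ) -
      ∫ z, Ψ (fun a => boxPoly e M (c a) (Function.update w i z)) ∂κ'| ∂Measure.pi lam :=
        abs_integral_le_integral_abs
    _ ≤ _ := integral_mono (a2.sub b2).abs ((a3.const_mul B).add (b3.const_mul B)) pt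
    _ ≤ B * R + B * R := by
        simp only [Pi.add_apply]
        rw [integral_add (a3.const_mul B) (b3.const_mul B), integral_const_mul,
          integral_const_mul]
        gcongr
    _ = _ := by ring

/-- The product measures with the first `t` factors from `ν` and the others from `μ`. -/
def hybrid (μ ν : Fin n → Measure E) (t : ℕ) (i : Fin n) : Measure E :=
  if i.val < t then ν i else μ i

theorem update_hybrid_left (μ ν : Fin n → Measure E) (i : Fin n) :
    Function.update (hybrid μ ν i) i (μ i) = hybrid μ ν i := by
  rw [Function.update_eq_self_iff]
  simp [hybrid]

theorem update_hybrid_right (μ ν : Fin n → Measure E) (i : Fin n) :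
    Function.update (hybrid μ ν i) i (ν i) = hybrid μ ν (i + 1) := by
  ext1 l
  by_cases hl : l = i
  · subst hl; simp [hybrid]
  · have : l.val ≠ i.val := fun h => hl (Fin.ext h)
    simp only [Function.update_of_ne hl, hybrid]
    congr 1
    exact propext ⟨fun h => by omega, fun h => by omega⟩

/-- The invariance principle for product measures. -/
theorem abs_integral_pi_sub_le (μ ν : Fin n → Measure E) [∀ i, IsProbabilityMeasure (μ i)]
    [∀ i, IsProbabilityMeasure (ν i)] (he : ∀ j, Measurable (e j)) (he0 : ∀ z, e 0 z = 1)
    (hη : 0 < η) (hη1 : η ≤ 1) (hμ : ∀ i, IsHyperBlock e η (M i) (μ i))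
    (hν : ∀ i, IsHyperBlock e η (M i) (ν i)) (hΨ : ContDiff ℝ 3 Ψ)
    (hB : ∀ (a₁ a₂ a₃ : Fin k) (x : Fin k → ℝ),
      |partialDeriv a₁ (partialDeriv a₂ (partialDeriv a₃ Ψ)) x| ≤ B) (hB0 : 0 ≤ B)
    {c : Fin k → (Fin n → ℕ) → ℝ} {d : ℕ}
    (hd : ∀ a, ∀ σ ∈ indexBox M, c a σ ≠ 0 → multiDegree σ ≤ d) :
    |(∫ x, Ψ (fun a => boxPoly e M (c a) x) ∂Measure.pi μ) -
      ∫ x, Ψ (fun a => boxPoly e M (c a) x) ∂Measure.pi ν| ≤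
      ∑ i, 2 * B * ((k : ℝ) ^ 2 *
        ∑ a, ((η⁻¹) ^ d * √(∑ σ ∈ indexBox M, activeCoeff i (c a) σ ^ 2)) ^ 3) := by
  have hp : ∀ t i, IsProbabilityMeasure (hybrid μ ν t i) := fun t i => by
    unfold hybrid; split_ifs <;> infer_instance
  have hh : ∀ t i, IsHyperBlock e η (M i) (hybrid μ ν t i) := fun t i => by
    unfold hybrid; split_ifs <;> [exact hν i; exact hμ i]
  set H : ℕ → ℝ := fun t => ∫ x, Ψ (fun a => boxPoly e M (c a) x) ∂Measure.pi (hybrid μ ν t)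
  have h0 : hybrid μ ν 0 = μ := by ext1 i; simp [hybrid]
  have hn : hybrid μ ν n = ν := by ext1 i; simp [hybrid]
  have hH : (∫ x, Ψ (fun a => boxPoly e M (c a) x) ∂Measure.pi μ) -
      ∫ x, Ψ (fun a => boxPoly e M (c a) x) ∂Measure.pi ν = -(H n - H 0) := by
    simp only [H, h0, hn]; ring
  -- The difference telescopes over the hybrids; consecutive ones differ only in the factor `i`.
  rw [hH, abs_neg, ← Finset.sum_range_sub, Finset.sum_range]
  refine (Finset.abs_sum_le_sum_abs _ _).trans (Finset.sum_le_sum fun i _ => ?_)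
  have := abs_integral_update_sub_le (hybrid μ ν i) he he0 hη hη1 (hh i) hΨ hB hB0 hd i (ν i)
    (μ i) (hν i) (hμ i)
  rwa [update_hybrid_left, update_hybrid_right] at this

/-- The monomials in orthonormal blocks are orthonormal. -/
theorem integral_prodFun_mul_prodFun (h : ∀ i, IsHyperBlock e η (M i) (lam i))
    {σ σ' : Fin n → ℕ} (hσ : σ ∈ indexBox M) (hσ' : σ' ∈ indexBox M) :
    ∫ x, prodFun e σ x * prodFun e σ' x ∂Measure.pi lam = if σ = σ' then 1 else 0 := by
  simp only [prodFun, ← Finset.prod_mul_distrib]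
  rw [integral_fintype_prod_eq_prod (fun i z => e (σ i) z * e (σ' i) z)]
  simp only [fun i => (h i).orthonormal _ (mem_indexBox.1 hσ i) _ (mem_indexBox.1 hσ' i)]
  split_ifs with hc
  · simp [hc]
  · obtain ⟨i, hi⟩ := Function.ne_iff.1 hc
    exact Finset.prod_eq_zero (Finset.mem_univ i) (if_neg hi)

theorem memLp_prodFun (he : ∀ j, Measurable (e j)) (he0 : ∀ z, e 0 z = 1) (hη : 0 < η)
    (hη1 : η ≤ 1) (h : ∀ i, IsHyperBlock e η (M i) (lam i)) {σ : Fin n → ℕ}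
    (hσ : σ ∈ indexBox M) : MemLp (prodFun e σ) 3 (Measure.pi lam) := by
  refine (memLp_boxPoly lam he he0 hη hη1 h (Pi.single σ 1)).ae_eq (.of_forall fun x => ?_)
  unfold boxPoly
  rw [Finset.sum_eq_single_of_mem σ hσ fun τ _ hτ => by simp [hτ]]
  simp

/-- Parseval's identity, from orthonormality of the monomials. -/
theorem integral_boxPoly_mul_boxPoly (he : ∀ j, Measurable (e j)) (he0 : ∀ z, e 0 z = 1)
    (hη : 0 < η) (hη1 : η ≤ 1) (h : ∀ i, IsHyperBlock e η (M i) (lam i))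
    (c c' : (Fin n → ℕ) → ℝ) :
    ∫ x, boxPoly e M c x * boxPoly e M c' x ∂Measure.pi lam =
      ∑ σ ∈ indexBox M, c σ * c' σ := by
  have hL : ∀ σ ∈ indexBox M, MemLp (prodFun e σ) 2 (Measure.pi lam) := fun σ hσ =>
    (memLp_prodFun lam he he0 hη hη1 h hσ).mono_exponent (by norm_num)
  have hi : ∀ σ ∈ indexBox M, ∀ σ' ∈ indexBox M,
      Integrable (fun x => c σ * c' σ' * (prodFun e σ x * prodFun e σ' x)) (Measure.pi lam) :=
    fun σ hσ σ' hσ' => ((hL σ hσ).integrable_mul (hL σ' hσ')).const_mul _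
  have e1 : ∀ x, boxPoly e M c x * boxPoly e M c' x = ∑ σ ∈ indexBox M, ∑ σ' ∈ indexBox M,
      c σ * c' σ' * (prodFun e σ x * prodFun e σ' x) := by
    intro x
    unfold boxPoly
    rw [Finset.sum_mul_sum]
    exact Finset.sum_congr rfl fun σ _ => Finset.sum_congr rfl fun σ' _ => by ring
  simp only [e1]
  rw [integral_finsetSum _ fun σ hσ => integrable_finsetSum _ fun σ' hσ' => hi σ hσ σ' hσ']
  refine Finset.sum_congr rfl fun σ hσ => ?_
  rw [integral_finsetSum _ fun σ' hσ' => hi σ hσ σ' hσ', Finset.sum_eq_single_of_mem σ hσ]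
  · rw [integral_const_mul, integral_prodFun_mul_prodFun lam h hσ hσ, if_pos rfl, mul_one]
  · intro σ' hσ' hne
    rw [integral_const_mul, integral_prodFun_mul_prodFun lam h hσ hσ', if_neg hne.symm, mul_zero]

end Product

/-! ### Hypercontractivity of a single ensemble on a finite probability space -/

theorem abs_add_pow_three_le (a t : ℝ) :
    |a + t| ^ 3 ≤ |a| ^ 3 + 3 * (a * |a|) * t + 3 * |a| * t ^ 2 + |t| ^ 3 := by
  -- If `a` and `a + t` have opposite signs, the two sides differ by twice this quantity; the
  -- quadratic form has negative discriminant.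
  have h : 0 ≤ |a| * (a ^ 2 + 3 * a * t + 3 * t ^ 2) :=
    mul_nonneg (abs_nonneg a) (by nlinarith [sq_nonneg (a + 3 / 2 * t), sq_nonneg t])
  rcases abs_cases a with ⟨h1, h1'⟩ | ⟨h1, h1'⟩ <;>
  rcases abs_cases t with ⟨h2, h2'⟩ | ⟨h2, h2'⟩ <;>
  rcases abs_cases (a + t) with ⟨h3, h3'⟩ | ⟨h3, h3'⟩ <;>
  rw [h1] at h <;> rw [h1, h2, h3] <;>
  nlinarith [h]

/-- After squaring, the odd cross terms are absorbed by AM-GM. The coefficients `3 / 4` and `1 / 8`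
come from `3 * η ^ 2 ≤ 3 / 4` and `η ^ 3 = √α / 8`. -/
theorem cube_add_le_sqrt_cube {A s : ℝ} (hA : 0 ≤ A) (hs : 0 ≤ s) :
    A ^ 3 + 3 / 4 * A * s ^ 2 + s ^ 3 / 8 ≤ √(A ^ 2 + s ^ 2) ^ 3 := by
  refine (pow_le_pow_iff_left₀ (by positivity) (by positivity) two_ne_zero).1 ?_
  have : (√(A ^ 2 + s ^ 2) ^ 3) ^ 2 = (A ^ 2 + s ^ 2) ^ 3 := by
    rw [← pow_mul, mul_comm, pow_mul, Real.sq_sqrt (by positivity)]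
  rw [this]
  have h1 : 2 * (A ^ 3 * s ^ 3) ≤ A ^ 4 * s ^ 2 + A ^ 2 * s ^ 4 := by
    nlinarith [mul_nonneg (sq_nonneg (A * s)) (sq_nonneg (A - s))]
  have h2 : 2 * (A * s ^ 5) ≤ A ^ 2 * s ^ 4 + s ^ 6 := by
    nlinarith [mul_nonneg (sq_nonneg (s ^ 2)) (sq_nonneg (A - s))]
  have p1 : 0 ≤ A ^ 4 * s ^ 2 := by positivity
  have p2 : 0 ≤ A ^ 2 * s ^ 4 := by positivity
  have p3 : 0 ≤ s ^ 6 := by positivity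
  nlinarith

theorem eLpNorm_three_le_of_integral_le {Ω : Type*} [MeasurableSpace Ω] {μ : Measure Ω}
    {f : Ω → ℝ} (hf : MemLp f 3 μ) {C : ℝ} (hC : 0 ≤ C) (h : ∫ ω, |f ω| ^ 3 ∂μ ≤ C ^ 3) :
    eLpNorm f 3 μ ≤ ENNReal.ofReal C := by
  rw [hf.eLpNorm_eq_integral_rpow_norm (by norm_num) (by norm_num)]
  refine ENNReal.ofReal_le_ofReal ?_
  have h0 : 0 ≤ ∫ ω, |f ω| ^ 3 ∂μ := integral_nonneg fun ω => by positivity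
  have e : ∫ ω, ‖f ω‖ ^ (3 : ENNReal).toReal ∂μ = ∫ ω, |f ω| ^ 3 ∂μ := by
    refine integral_congr_ae (.of_forall fun ω => ?_)
    have : (3 : ENNReal).toReal = ((3 : ℕ) : ℝ) := by simp
    simp only [this, Real.rpow_natCast, Real.norm_eq_abs]
  rw [e]
  calc (∫ ω, |f ω| ^ 3 ∂μ) ^ ((3 : ENNReal).toReal)⁻¹ ≤ (C ^ 3) ^ ((3 : ENNReal).toReal)⁻¹ := by
        gcongr
    _ = C := by
        have := Real.pow_rpow_inv_natCast hC (n := 3) (by norm_num)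
        simpa using this

/-- A mean zero function that is bounded in terms of its variance is `(2, 3)`-hypercontractive. -/
theorem eLpNorm_const_add_mul_le {Ω : Type*} [MeasurableSpace Ω] {μ : Measure Ω}
    [IsProbabilityMeasure μ] {g : Ω → ℝ} (hg : Measurable g) {V α η : ℝ} (hα : 0 < α)
    (hη : 0 < η) (hη2 : η ^ 2 ≤ 1 / 4) (hη3 : η ^ 3 = √α / 8) (hV : ∫ ω, g ω ^ 2 ∂μ = V)
    (h0 : ∫ ω, g ω ∂μ = 0) (hb : ∀ᵐ ω ∂μ, g ω ^ 2 ≤ V / α) (a : ℝ) :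
    eLpNorm (fun ω => a + η * g ω) 3 μ ≤ ENNReal.ofReal (√(a ^ 2 + V)) := by
  have hV0 : 0 ≤ V := by rw [← hV]; exact integral_nonneg fun ω => sq_nonneg _
  have hb' : ∀ᵐ ω ∂μ, |g ω| ≤ √(V / α) := by
    filter_upwards [hb] with ω hω
    exact Real.abs_le_sqrt hω
  have hL : ∀ p, MemLp g p μ := fun p => MemLp.of_bound hg.aestronglyMeasurable _ hb'
  have i1 : Integrable g μ := memLp_one_iff_integrable.1 (hL 1)
  have i2 : Integrable (fun ω => g ω ^ 2) μ := (hL 2).integrable_sq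
  have i3 : Integrable (fun ω => |g ω| ^ 3) μ := by
    simpa using (hL 3).integrable_norm_pow (p := 3) (by norm_num)
  have hf : MemLp (fun ω => a + η * g ω) 3 μ := (memLp_const a).add ((hL 3).const_mul η)
  refine eLpNorm_three_le_of_integral_le hf (Real.sqrt_nonneg _) ?_
  have if3 : Integrable (fun ω => |a + η * g ω| ^ 3) μ := by
    simpa using hf.integrable_norm_pow (p := 3) (by norm_num)
  have k3 : ∫ ω, |g ω| ^ 3 ∂μ ≤ √(V / α) * V := by
    rw [← hV, ← integral_const_mul, hV]
    refine integral_mono_ae i3 (i2.const_mul _) ?_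
    filter_upwards [hb'] with ω hω
    rw [← sq_abs (g ω)]
    calc |g ω| ^ 3 = |g ω| * |g ω| ^ 2 := by ring
      _ ≤ _ := by gcongr
  have j1 : Integrable (fun ω => |a| ^ 3 + 3 * (a * |a|) * η * g ω) μ :=
    (integrable_const _).add (i1.const_mul _)
  have j2 : Integrable (fun ω => 3 * |a| * η ^ 2 * g ω ^ 2) μ := i2.const_mul _
  have j3 : Integrable (fun ω => η ^ 3 * |g ω| ^ 3) μ := i3.const_mul _
  have k1 : ∫ ω, |a + η * g ω| ^ 3 ∂μ ≤
      |a| ^ 3 + 3 * |a| * η ^ 2 * V + η ^ 3 * ∫ ω, |g ω| ^ 3 ∂μ := by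
    calc _ ≤ ∫ ω, (|a| ^ 3 + 3 * (a * |a|) * η * g ω) + 3 * |a| * η ^ 2 * g ω ^ 2 +
          η ^ 3 * |g ω| ^ 3 ∂μ := by
          refine integral_mono if3 ((j1.add j2).add j3) fun ω => ?_
          refine (abs_add_pow_three_le a (η * g ω)).trans (le_of_eq ?_)
          simp only [abs_mul, abs_of_pos hη]
          ring
      _ = _ := by
          rw [integral_add (f := fun ω => (|a| ^ 3 + 3 * (a * |a|) * η * g ω) +
              3 * |a| * η ^ 2 * g ω ^ 2) (j1.add j2) j3, integral_add j1 j2,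
            integral_add (integrable_const _) (i1.const_mul _), integral_const_mul,
            integral_const_mul, integral_const_mul, h0, hV]
          simp
  refine k1.trans ?_
  -- The `√α` in `η ^ 3` cancels the one in the supremum bound for `g`.
  have e1 : η ^ 3 * (√(V / α) * V) = √V ^ 3 / 8 := by
    rw [hη3, Real.sqrt_div hV0]
    have : √α ≠ 0 := (Real.sqrt_pos.2 hα).ne'
    field_simp
    rw [pow_succ, Real.sq_sqrt hV0]
    ring
  have e2 := cube_add_le_sqrt_cube (abs_nonneg a) (Real.sqrt_nonneg V)
  rw [sq_abs, Real.sq_sqrt hV0] at e2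
  refine le_trans ?_ e2
  have e3 : η ^ 3 * ∫ ω, |g ω| ^ 3 ∂μ ≤ √V ^ 3 / 8 := by
    rw [← e1]; gcongr
  have e4 : 3 * |a| * η ^ 2 * V ≤ 3 / 4 * |a| * V := by
    have : 0 ≤ |a| * V := by positivity
    nlinarith
  linarith

/-- A single atom of mass at least `α` already contributes `α * G s ^ 2` to the integral. -/
theorem ae_sq_le_integral_div {S : Type*} [Finite S] [MeasurableSpace S]
    [MeasurableSingletonClass S] (μ : Measure S) [IsProbabilityMeasure μ] {α : ℝ} (hα : 0 < α)
    (h : ∀ s, μ.real {s} ≠ 0 → α ≤ μ.real {s}) (G : S → ℝ) :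
    ∀ᵐ s ∂μ, G s ^ 2 ≤ (∫ s, G s ^ 2 ∂μ) / α := by
  have := Fintype.ofFinite S
  have h1 : ∀ᵐ s ∂μ, μ.real {s} ≠ 0 := by
    rw [ae_iff]
    simp only [ne_eq, not_not]
    rw [← Set.biUnion_of_singleton {s | μ.real {s} = 0},
      measure_biUnion_null_iff (Set.to_countable _)]
    intro s hs
    exact (measureReal_eq_zero_iff).1 hs
  filter_upwards [h1] with s hs
  rw [le_div_iff₀ hα, integral_fintype .of_finite]
  simp only [smul_eq_mul]
  calc G s ^ 2 * α ≤ μ.real {s} * G s ^ 2 := by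
        rw [mul_comm]; gcongr; exact h s hs
    _ ≤ _ := Finset.single_le_sum (f := fun s => μ.real {s} * G s ^ 2)
        (fun s _ => by positivity) (Finset.mem_univ s)

/-! ### Ensembles -/

section Ensemble

variable {n : ℕ} {Ω : Type*} [MeasurableSpace Ω] {P : Measure Ω}
  {m M : Fin n → ℕ} {X : Fin n → ℕ → Ω → ℝ}

theorem IsEnsembleSeq.integral_sum_sq (hX : IsEnsembleSeq P m X) (i : Fin n) {s : Finset ℕ}
    (hs : ∀ j ∈ s, j ≤ m i) (c : ℕ → ℝ) :
    ∫ ω, (∑ j ∈ s, c j * X i j ω) ^ 2 ∂P = ∑ j ∈ s, c j ^ 2 := by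
  have hi : ∀ j ∈ s, ∀ j' ∈ s, Integrable (fun ω => c j * c j' * (X i j ω * X i j' ω)) P :=
    fun j hj j' hj' => ((hX.memLp_two i j (hs j hj)).integrable_mul
      (hX.memLp_two i j' (hs j' hj'))).const_mul _
  have e1 : ∀ ω, (∑ j ∈ s, c j * X i j ω) ^ 2 =
      ∑ j ∈ s, ∑ j' ∈ s, c j * c j' * (X i j ω * X i j' ω) := by
    intro ω
    rw [sq, Finset.sum_mul_sum]
    exact Finset.sum_congr rfl fun j _ => Finset.sum_congr rfl fun j' _ => by ring
  simp only [e1]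
  rw [integral_finsetSum _ fun j hj => integrable_finsetSum _ fun j' hj' => hi j hj j' hj']
  refine Finset.sum_congr rfl fun j hj => ?_
  rw [integral_finsetSum _ fun j' hj' => hi j hj j' hj', Finset.sum_eq_single_of_mem j hj]
  · rw [integral_const_mul, hX.orthonormal i j (hs j hj) j (hs j hj), if_pos rfl]
    ring
  · intro j' hj' hne
    rw [integral_const_mul, hX.orthonormal i j (hs j hj) j' (hs j' hj'), if_neg hne.symm,
      mul_zero]

theorem IsEnsembleSeq.integral_eq_zero (hX : IsEnsembleSeq P m X) (i : Fin n) {j : ℕ}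
    (hj : j ≤ m i) (hj0 : j ≠ 0) : ∫ ω, X i j ω ∂P = 0 := by
  have := hX.orthonormal i j hj 0 (Nat.zero_le _)
  simpa [hX.zero_eq_one, hj0] using this

theorem IsEnsembleSeq.integrable [IsProbabilityMeasure P] (hX : IsEnsembleSeq P m X) (i : Fin n) {j : ℕ}
    (hj : j ≤ m i) : Integrable (X i j) P :=
  (hX.memLp_two i j hj).integrable (by norm_num)

/-- Wolff's theorem for a single ensemble. -/
theorem IsEnsembleSeq.eLpNorm_block_le_of_finite [IsProbabilityMeasure P]
    (hX : IsEnsembleSeq P m X) (i : Fin n)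
    {S : Type*} [Finite S] [MeasurableSpace S] [MeasurableSingletonClass S] (μ : Measure S)
    [IsProbabilityMeasure μ] {ξ : Ω → S} (hξ : MeasurePreserving ξ P μ) {b : ℕ → S → ℝ}
    (hXb : ∀ j ≤ m i, ∀ ω, X i j ω = b j (ξ ω)) {α η : ℝ} (hα : 0 < α)
    (hatom : ∀ s, μ.real {s} ≠ 0 → α ≤ μ.real {s})
    (hη : 0 < η) (hη2 : η ^ 2 ≤ 1 / 4) (hη3 : η ^ 3 = √α / 8) {N : ℕ} (hN : N ≤ m i)
    (c : ℕ → ℝ) :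
    eLpNorm (fun ω => ∑ j ∈ Finset.range (N + 1), c j * ((if 0 < j then η else 1) * X i j ω)) 3 P
      ≤ ENNReal.ofReal (√(∑ j ∈ Finset.range (N + 1), c j ^ 2)) := by
  set g : Ω → ℝ := fun ω => ∑ j ∈ Finset.range N, c (j + 1) * X i (j + 1) ω with hg
  have hle : ∀ j ∈ Finset.range N, j + 1 ≤ m i := fun j hj =>
    (Nat.succ_le_of_lt (Finset.mem_range.1 hj)).trans hN
  have hgm : Measurable g := Finset.measurable_fun_sum _ fun j hj =>
    (hX.measurable i _ (hle j hj)).const_mul _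
  have hV : ∫ ω, g ω ^ 2 ∂P = ∑ j ∈ Finset.range N, c (j + 1) ^ 2 := by
    have := hX.integral_sum_sq i (s := (Finset.range N).map (addRightEmbedding 1)) (by
      intro j hj
      obtain ⟨l, hl, rfl⟩ := Finset.mem_map.1 hj
      exact hle l hl) c
    simpa [Finset.sum_map] using this
  have h0 : ∫ ω, g ω ∂P = 0 := by
    rw [integral_finsetSum _ fun j hj => (hX.integrable i (hle j hj)).const_mul _]
    refine Finset.sum_eq_zero fun j hj => ?_
    rw [integral_const_mul, hX.integral_eq_zero i (hle j hj) (Nat.succ_ne_zero j), mul_zero]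
  set G : S → ℝ := fun s => ∑ j ∈ Finset.range N, c (j + 1) * b (j + 1) s with hG
  have hgG : ∀ ω, g ω = G (ξ ω) := fun ω =>
    Finset.sum_congr rfl fun j hj => by rw [hXb _ (hle j hj)]
  have hVG : ∫ s, G s ^ 2 ∂μ = ∑ j ∈ Finset.range N, c (j + 1) ^ 2 := by
    rw [← hV, ← hξ.map_eq, integral_map hξ.measurable.aemeasurable
      (measurable_of_finite _).aestronglyMeasurable]
    simp only [hgG]
  have hb : ∀ᵐ ω ∂P, g ω ^ 2 ≤ (∑ j ∈ Finset.range N, c (j + 1) ^ 2) / α := by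
    have := hξ.quasiMeasurePreserving.ae (ae_sq_le_integral_div μ hα hatom G)
    filter_upwards [this] with ω hω
    rwa [hgG, ← hVG]
  have key := eLpNorm_const_add_mul_le hgm hα hη hη2 hη3 hV h0 hb (c 0)
  have e0 : ∑ j ∈ Finset.range (N + 1), c j ^ 2 =
      c 0 ^ 2 + ∑ j ∈ Finset.range N, c (j + 1) ^ 2 := by
    rw [Finset.sum_range_succ', add_comm]
  rw [e0]
  convert key using 2
  ext ω
  rw [Finset.sum_range_succ', add_comm (Finset.sum _ _), hg, Finset.mul_sum]
  simp only [hX.zero_eq_one, lt_irrefl, if_false, mul_one, Nat.succ_pos, if_true]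
  congr 1
  exact Finset.sum_congr rfl fun j _ => by ring

theorem eLpNorm_two_eq_sqrt {f : Ω → ℝ} (hf : MemLp f 2 P) :
    eLpNorm f 2 P = ENNReal.ofReal (√(∫ ω, f ω ^ 2 ∂P)) := by
  rw [hf.eLpNorm_eq_integral_rpow_norm (by norm_num) (by norm_num), Real.sqrt_eq_rpow]
  simp

theorem multiDegree_single (i : Fin n) (j : ℕ) :
    multiDegree (Pi.single i j : Fin n → ℕ) = if 0 < j then 1 else 0 := by
  unfold multiDegree
  split_ifs with hj
  · rw [Finset.card_eq_one]
    refine ⟨i, ?_⟩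
    ext l
    by_cases hl : l = i
    · subst hl; simp [hj]
    · simp [hl]
  · have : j = 0 := by omega
    simp [this]

theorem prod_apply_single (hX : IsEnsembleSeq P m X) (i : Fin n) (j : ℕ) (ω : Ω) :
    ∏ l, X l ((Pi.single i j : Fin n → ℕ) l) ω = X i j ω := by
  rw [Finset.prod_eq_single i]
  · simp
  · intro l _ hl
    simp [hl, hX.zero_eq_one]
  · simp

/-- Hypercontractivity passes to a single ensemble. -/
theorem IsEnsembleSeq.eLpNorm_block_le_of_isHypercontractive (hX : IsEnsembleSeq P m X) {η : ℝ}
    (h : IsHypercontractive P m X 2 3 η) (i : Fin n) {N : ℕ} (hN : N ≤ m i) (c : ℕ → ℝ) :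
    eLpNorm (fun ω => ∑ j ∈ Finset.range (N + 1), c j * ((if 0 < j then η else 1) * X i j ω)) 3 P
      ≤ ENNReal.ofReal (√(∑ j ∈ Finset.range (N + 1), c j ^ 2)) := by
  -- The test polynomial involves block `i` only; the index `Pi.single i 0` is the constant
  -- monomial.
  set Q : MultilinearPoly n :=
    ∑ j ∈ Finset.range (N + 1), Finsupp.single (Pi.single i j) (c j) with hQ
  have hle : ∀ j ∈ Finset.range (N + 1), j ≤ m i := fun j hj =>
    (Nat.lt_succ_iff.1 (Finset.mem_range.1 hj)).trans hN
  have hover : Q.IsOver m := by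
    intro σ hσ l
    obtain ⟨j, hj, hσ⟩ := Finset.mem_biUnion.1 (Finsupp.support_finsetSum hσ)
    have := Finset.mem_singleton.1 (Finsupp.support_single_subset hσ)
    subst this
    by_cases hl : l = i
    · subst hl; simpa using hle j hj
    · simp [hl]
  have e1 : ∀ ω, Q.apply X ω = ∑ j ∈ Finset.range (N + 1), c j * X i j ω := by
    intro ω
    change Q.sum (fun σ a => a * ∏ l, X l (σ l) ω) = _
    rw [hQ, ← Finsupp.sum_finsetSum_index (by simp) (by intros; ring)]
    refine Finset.sum_congr rfl fun j _ => ?_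
    rw [Finsupp.sum_single_index (by simp), prod_apply_single hX]
  have e2 : ∀ ω, (Q.noise η).apply X ω =
      ∑ j ∈ Finset.range (N + 1), c j * ((if 0 < j then η else 1) * X i j ω) := by
    intro ω
    change (Q.noise η).sum (fun σ a => a * ∏ l, X l (σ l) ω) = _
    unfold MultilinearPoly.noise
    rw [Finsupp.onFinset_sum _ (by simp)]
    change Q.sum (fun σ a => η ^ multiDegree σ * a * ∏ l, X l (σ l) ω) = _
    rw [hQ, ← Finsupp.sum_finsetSum_index (by simp) (by intros; ring)]
    refine Finset.sum_congr rfl fun j _ => ?_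
    rw [Finsupp.sum_single_index (by simp), prod_apply_single hX, multiDegree_single]
    split_ifs <;> ring
  have key := h Q hover
  have f1 : Q.apply X = fun ω => ∑ j ∈ Finset.range (N + 1), c j * X i j ω := funext e1
  have f2 : (Q.noise η).apply X = _ := funext e2
  -- By orthonormality the `L²` norm on the right is the `ℓ²` norm of `c`.
  rw [f1, f2, eLpNorm_two_eq_sqrt (memLp_finsetSum _ fun j hj =>
    (hX.memLp_two i j (hle j hj)).const_mul _), hX.integral_sum_sq i hle] at key
  exact key

end Ensemble

/-! ### The laws of the ensembles -/

/-- The `j`-th coordinate function on `ℕ → ℝ`, with the `0`-th replaced by the constant `1`. -/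
def coordFun (j : ℕ) (z : ℕ → ℝ) : ℝ := if j = 0 then 1 else z j

theorem measurable_coordFun (j : ℕ) : Measurable (coordFun j) := by
  unfold coordFun
  split_ifs
  · exact measurable_const
  · exact measurable_pi_apply j

theorem coordFun_zero (z : ℕ → ℝ) : coordFun 0 z = 1 := if_pos rfl

section Transfer

variable {n : ℕ} {Ω : Type*} {m M : Fin n → ℕ} {X : Fin n → ℕ → Ω → ℝ}

/-- The values of the ensembles `{X i 0, …, X i (M i)}`, padded by zeros. -/
def ensembleVec (M : Fin n → ℕ) (X : Fin n → ℕ → Ω → ℝ) (ω : Ω) (i : Fin n) (j : ℕ) : ℝ :=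
  if j ≤ M i then X i j ω else 0

/-- The law of the `i`-th ensemble. -/
def ensembleLaw [MeasurableSpace Ω] (P : Measure Ω) (M : Fin n → ℕ) (X : Fin n → ℕ → Ω → ℝ)
    (i : Fin n) : Measure (ℕ → ℝ) :=
  P.map fun ω => ensembleVec M X ω i

variable [MeasurableSpace Ω] {P : Measure Ω}

theorem IsEnsembleSeq.coordFun_ensembleVec (hX : IsEnsembleSeq P m X) (i : Fin n) {j : ℕ}
    (hj : j ≤ M i) (ω : Ω) : coordFun j (ensembleVec M X ω i) = X i j ω := by
  unfold coordFun ensembleVec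
  split_ifs with h
  · rw [h, hX.zero_eq_one]
  · rfl

theorem IsEnsembleSeq.prodFun_ensembleVec (hX : IsEnsembleSeq P m X) {σ : Fin n → ℕ}
    (hσ : σ ∈ indexBox M) (ω : Ω) :
    prodFun coordFun σ (ensembleVec M X ω) = ∏ l, X l (σ l) ω :=
  Finset.prod_congr rfl fun l _ => hX.coordFun_ensembleVec l (mem_indexBox.1 hσ l) ω

theorem IsEnsembleSeq.measurable_ensembleVec (hX : IsEnsembleSeq P m X) (hM : ∀ i, M i ≤ m i)
    (i : Fin n) : Measurable fun ω => ensembleVec M X ω i := by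
  refine measurable_pi_lambda _ fun j => ?_
  unfold ensembleVec
  split_ifs with h
  · exact hX.measurable i j (h.trans (hM i))
  · exact measurable_const

theorem isProbabilityMeasure_ensembleLaw [IsProbabilityMeasure P] (hX : IsEnsembleSeq P m X)
    (hM : ∀ i, M i ≤ m i) (i : Fin n) : IsProbabilityMeasure (ensembleLaw P M X i) :=
  Measure.isProbabilityMeasure_map (hX.measurable_ensembleVec hM i).aemeasurable

/-- Independence of the ensembles says that their joint law is the product of their laws; truncating
and padding act on each ensemble separately. -/
theorem IsEnsembleSeq.measurePreserving [IsProbabilityMeasure P] (hX : IsEnsembleSeq P m X)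
    (hM : ∀ i, M i ≤ m i) :
    MeasurePreserving (ensembleVec M X) P (Measure.pi (ensembleLaw P M X)) := by
  have hm := hX.measurable_ensembleVec hM
  refine ⟨measurable_pi_lambda _ hm, ?_⟩
  refine (iIndepFun_iff_map_fun_eq_pi_map fun i => (hm i).aemeasurable).1 ?_
  have := hX.indep.comp (fun i (v : Fin (m i + 1) → ℝ) (j : ℕ) =>
    if h : j ≤ M i then v ⟨j, Nat.lt_succ_of_le (h.trans (hM i))⟩ else 0) (fun i => by
      refine measurable_pi_lambda _ fun j => ?_
      split_ifs with h
      · exact measurable_pi_apply _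
      · exact measurable_const)
  convert this using 1
  ext i ω j
  simp [ensembleVec]

theorem IsEnsembleSeq.isHyperBlock (hX : IsEnsembleSeq P m X) (hM : ∀ i, M i ≤ m i) {η : ℝ}
    {i : Fin n} (h : ∀ c : ℕ → ℝ, eLpNorm (fun ω => ∑ j ∈ Finset.range (M i + 1),
      c j * ((if 0 < j then η else 1) * X i j ω)) 3 P ≤
      ENNReal.ofReal (√(∑ j ∈ Finset.range (M i + 1), c j ^ 2))) :
    IsHyperBlock coordFun η (M i) (ensembleLaw P M X i) where
  orthonormal j hj j' hj' := by
    unfold ensembleLaw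
    rw [integral_map (f := fun z => coordFun j z * coordFun j' z)
      (hX.measurable_ensembleVec hM i).aemeasurable ((measurable_coordFun j).mul (measurable_coordFun j')).aestronglyMeasurable]
    simp only [hX.coordFun_ensembleVec i hj, hX.coordFun_ensembleVec i hj']
    exact hX.orthonormal i j (hj.trans (hM i)) j' (hj'.trans (hM i))
  hyper c := by
    unfold ensembleLaw
    rw [eLpNorm_map_measure (Finset.measurable_fun_sum _ fun j _ =>
      ((measurable_coordFun j).const_mul _).const_mul _).aestronglyMeasurable
      (hX.measurable_ensembleVec hM i).aemeasurable]
    refine le_trans (le_of_eq ?_) (h c)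
    congr 1
    ext ω
    refine Finset.sum_congr rfl fun j hj => ?_
    rw [hX.coordFun_ensembleVec i (Nat.lt_succ_iff.1 (Finset.mem_range.1 hj))]

theorem IsEnsembleSeq.apply_eq_boxPoly (hX : IsEnsembleSeq P m X) {Q : MultilinearPoly n}
    (hQ : Q.IsOver M) (ω : Ω) : Q.apply X ω = boxPoly coordFun M Q (ensembleVec M X ω) := by
  unfold MultilinearPoly.apply MultilinearPoly.eval boxPoly
  rw [Finset.sum_subset (s₂ := indexBox M) fun σ hσ => mem_indexBox.2 (hQ σ hσ)]
  · exact Finset.sum_congr rfl fun σ hσ => by rw [hX.prodFun_ensembleVec hσ]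
  · intro σ _ hσ
    rw [Finsupp.notMem_support_iff.1 hσ, zero_mul]

theorem integral_comp_of_measurePreserving {β : Type*} [MeasurableSpace β] {μ : Measure β}
    {T : Ω → β} (hT : MeasurePreserving T P μ) {f : β → ℝ} (hf : Measurable f) :
    ∫ ω, f (T ω) ∂P = ∫ x, f x ∂μ := by
  rw [← hT.map_eq, integral_map hT.measurable.aemeasurable hf.aestronglyMeasurable]

end Transfer

/-! ### Variance and influences in terms of the coefficients -/

section Moments

variable {n : ℕ} {Ω : Type*} {m M : Fin n → ℕ} {X : Fin n → ℕ → Ω → ℝ} {η : ℝ}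

theorem measurable_sigmaExcept {i l : Fin n} (hl : l ≠ i) {j : ℕ} (hj : j ≤ m l) :
    Measurable[sigmaExcept m X i] (X l j) := by
  rw [measurable_iff_comap_le]
  exact le_trans (le_iSup (fun j : Fin (m l + 1) => MeasurableSpace.comap (X l j) inferInstance)
    ⟨j, Nat.lt_succ_of_le hj⟩) (le_iSup (fun l : {l : Fin n // l ≠ i} =>
      ⨆ j : Fin (m l + 1), MeasurableSpace.comap (X l j) inferInstance) ⟨l, hl⟩)

variable [MeasurableSpace Ω] {P : Measure Ω}

theorem IsEnsembleSeq.sigmaExcept_le (hX : IsEnsembleSeq P m X) (i : Fin n) :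
    sigmaExcept m X i ≤ ‹MeasurableSpace Ω› :=
  iSup_le fun l => iSup_le fun j =>
    (hX.measurable l j (Nat.lt_succ_iff.1 j.2)).comap_le

theorem IsEnsembleSeq.indep_sigmaExcept (hX : IsEnsembleSeq P m X) (i : Fin n) {j : ℕ}
    (hj : j ≤ m i) :
    Indep (MeasurableSpace.comap (X i j) inferInstance) (sigmaExcept m X i) P := by
  have hvec : ∀ l, Measurable fun ω (j : Fin (m l + 1)) => X l j ω := fun l =>
    measurable_pi_lambda _ fun j => hX.measurable l j (Nat.lt_succ_iff.1 j.2)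
  have hcoord : ∀ l (j : Fin (m l + 1)), MeasurableSpace.comap (X l j) inferInstance ≤
      MeasurableSpace.comap (fun ω (j : Fin (m l + 1)) => X l j ω) inferInstance := by
    intro l j
    rw [← measurable_iff_comap_le]
    exact (measurable_pi_apply j).comp
      (comap_measurable fun ω (j : Fin (m l + 1)) => X l j ω)
  have key := indep_iSup_of_disjoint (fun l => (hvec l).comap_le) hX.indep
    (S := {i}) (T := {l | l ≠ i}) (by simp)
  refine indep_of_indep_of_le_left (indep_of_indep_of_le_right key ?_) ?_
  · exact iSup_le fun l => iSup_le fun j => (hcoord l j).trans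
      (le_iSup₂_of_le (f := fun l (_ : l ∈ {l | l ≠ i}) => MeasurableSpace.comap
        (fun ω (j : Fin (m l + 1)) => X l j ω) inferInstance) l.1 l.2 le_rfl)
  · exact (hcoord i ⟨j, Nat.lt_succ_of_le hj⟩).trans
      (le_iSup₂_of_le (f := fun l (_ : l ∈ ({i} : Set (Fin n))) => MeasurableSpace.comap
        (fun ω (j : Fin (m l + 1)) => X l j ω) inferInstance) i rfl le_rfl)

variable [IsProbabilityMeasure P]

theorem IsEnsembleSeq.integral_boxPoly_mul_boxPoly (hX : IsEnsembleSeq P m X)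
    (hM : ∀ i, M i ≤ m i) (hη : 0 < η) (hη1 : η ≤ 1)
    (h : ∀ i, IsHyperBlock coordFun η (M i) (ensembleLaw P M X i)) (c c' : (Fin n → ℕ) → ℝ) :
    ∫ ω, boxPoly coordFun M c (ensembleVec M X ω) * boxPoly coordFun M c' (ensembleVec M X ω) ∂P =
      ∑ σ ∈ indexBox M, c σ * c' σ := by
  have := isProbabilityMeasure_ensembleLaw hX hM
  rw [integral_comp_of_measurePreserving (hX.measurePreserving hM)
    (f := fun x => boxPoly coordFun M c x * boxPoly coordFun M c' x)
    ((measurable_boxPoly measurable_coordFun c).mul (measurable_boxPoly measurable_coordFun c'))]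
  exact Invariance.integral_boxPoly_mul_boxPoly _ measurable_coordFun coordFun_zero hη hη1 h c c'

theorem IsEnsembleSeq.memLp_boxPoly (hX : IsEnsembleSeq P m X)
    (hM : ∀ i, M i ≤ m i) (hη : 0 < η) (hη1 : η ≤ 1)
    (h : ∀ i, IsHyperBlock coordFun η (M i) (ensembleLaw P M X i)) (c : (Fin n → ℕ) → ℝ) :
    MemLp (fun ω => boxPoly coordFun M c (ensembleVec M X ω)) 3 P := by
  have := isProbabilityMeasure_ensembleLaw hX hM
  exact (Invariance.memLp_boxPoly _ measurable_coordFun coordFun_zero hη hη1 h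
    c).comp_measurePreserving (hX.measurePreserving hM)

theorem boxPoly_single_zero (x : Fin n → ℕ → ℝ) :
    boxPoly coordFun M (Pi.single 0 1) x = 1 := by
  unfold boxPoly
  rw [Finset.sum_eq_single_of_mem 0 (mem_indexBox.2 fun i => Nat.zero_le _) fun τ _ hτ => by
    simp [hτ]]
  simp [prodFun, coordFun_zero]

theorem IsEnsembleSeq.vecVariance_eq (hX : IsEnsembleSeq P m X)
    (hM : ∀ i, M i ≤ m i) (hη : 0 < η) (hη1 : η ≤ 1)
    (h : ∀ i, IsHyperBlock coordFun η (M i) (ensembleLaw P M X i)) {k : ℕ}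
    {Q : Fin k → MultilinearPoly n} (hQ : ∀ a, (Q a).IsOver M) :
    vecVariance P X Q = ∑ a, ∑ σ ∈ indexBox M, (if σ = 0 then 0 else Q a σ) ^ 2 := by
  have e1 : ∀ a, ∫ ω, (Q a).apply X ω ∂P = Q a 0 := by
    intro a
    -- The mean is the pairing with the constant polynomial `1`.
    have := hX.integral_boxPoly_mul_boxPoly hM hη hη1 h (Q a) (Pi.single 0 1)
    simp only [boxPoly_single_zero, mul_one, ← hX.apply_eq_boxPoly (hQ a)] at this
    rw [this, Finset.sum_eq_single_of_mem 0 (mem_indexBox.2 fun i => Nat.zero_le _)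
      fun τ _ hτ => by simp [hτ]]
    simp
  have e2 : ∀ a ω, (Q a).apply X ω - Q a 0 =
      boxPoly coordFun M (fun σ => if σ = 0 then 0 else Q a σ) (ensembleVec M X ω) := by
    intro a ω
    have h0 : Q a 0 = Q a 0 * boxPoly coordFun M (Pi.single 0 1) (ensembleVec M X ω) := by
      rw [boxPoly_single_zero, mul_one]
    rw [hX.apply_eq_boxPoly (hQ a), h0]
    unfold boxPoly
    rw [Finset.mul_sum, ← Finset.sum_sub_distrib]
    refine Finset.sum_congr rfl fun σ _ => ?_
    by_cases hσ : σ = 0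
    · subst hσ; simp
    · simp [hσ]
  unfold vecVariance
  simp only [e1, e2]
  rw [integral_finsetSum _ fun a _ => ((hX.memLp_boxPoly hM hη hη1 h _).mono_exponent
    (by norm_num : (2 : ENNReal) ≤ 3)).integrable_sq]
  refine Finset.sum_congr rfl fun a _ => ?_
  simp only [sq]
  exact hX.integral_boxPoly_mul_boxPoly hM hη hη1 h _ _

/-- The factors other than the `i`-th are measurable for the conditioning and come out. The `i`-th
is independent of it and has mean zero unless it is the constant `1`. -/
theorem IsEnsembleSeq.condExp_monomial (hX : IsEnsembleSeq P m X) (i : Fin n) {σ : Fin n → ℕ}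
    (hσ : ∀ l, σ l ≤ m l) (hint : Integrable (fun ω => ∏ l, X l (σ l) ω) P) :
    P[fun ω => ∏ l, X l (σ l) ω | sigmaExcept m X i] =ᵐ[P]
      fun ω => if σ i = 0 then ∏ l, X l (σ l) ω else 0 := by
  have hle := hX.sigmaExcept_le i
  set D : Ω → ℝ := fun ω => ∏ l ∈ Finset.univ.erase i, X l (σ l) ω with hD
  have hDm : StronglyMeasurable[sigmaExcept m X i] D := by
    refine Measurable.stronglyMeasurable ?_
    exact Finset.measurable_fun_prod _ fun l hl =>
      measurable_sigmaExcept (Finset.ne_of_mem_erase hl) (hσ l)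
  have hprod : (fun ω => ∏ l, X l (σ l) ω) = D * X i (σ i) := by
    ext ω
    rw [Pi.mul_apply, mul_comm]
    exact (Finset.mul_prod_erase _ (fun l => X l (σ l) ω) (Finset.mem_univ i)).symm
  by_cases h0 : σ i = 0
  · have : (fun ω => ∏ l, X l (σ l) ω) = D := by
      rw [hprod, h0]
      ext ω
      simp [hX.zero_eq_one]
    simp only [h0, if_true]
    rw [this] at hint ⊢
    rw [condExp_of_stronglyMeasurable hle hDm hint]
  · have h1 := condExp_mul_of_stronglyMeasurable_left (g := X i (σ i)) hDm (hprod ▸ hint)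
      (hX.integrable i (hσ i))
    have h2 := condExp_indep_eq (f := X i (σ i)) (hX.measurable i _ (hσ i)).comap_le hle
      (comap_measurable _).stronglyMeasurable (hX.indep_sigmaExcept i (hσ i))
    rw [hprod]
    filter_upwards [h1, h2] with ω w1 w2
    rw [w1, Pi.mul_apply, w2, hX.integral_eq_zero i (hσ i) h0]
    simp [h0]

/-- Conditioning deletes the monomials that involve block `i`, so the deviation from the conditional
mean is the active part; Parseval's identity gives its second moment. -/
theorem IsEnsembleSeq.influence_eq (hX : IsEnsembleSeq P m X)
    (hM : ∀ i, M i ≤ m i) (hη : 0 < η) (hη1 : η ≤ 1)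
    (h : ∀ i, IsHyperBlock coordFun η (M i) (ensembleLaw P M X i)) {k : ℕ}
    {Q : Fin k → MultilinearPoly n} (hQ : ∀ a, (Q a).IsOver M) (i : Fin n) :
    influence P m X Q i = ∑ a, ∑ σ ∈ indexBox M, activeCoeff i (Q a) σ ^ 2 := by
  have hp := isProbabilityMeasure_ensembleLaw hX hM
  have hle := hX.sigmaExcept_le i
  unfold influence
  refine Finset.sum_congr rfl fun a _ => ?_
  have hmono : ∀ σ ∈ indexBox M, Integrable (fun ω => ∏ l, X l (σ l) ω) P := by
    intro σ hσ
    have := ((memLp_prodFun _ measurable_coordFun coordFun_zero hη hη1 h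
      hσ).comp_measurePreserving (hX.measurePreserving hM)).integrable (by norm_num)
    refine this.congr (.of_forall fun ω => ?_)
    exact hX.prodFun_ensembleVec hσ ω
  have hcm : ∀ σ ∈ indexBox M, P[fun ω => Q a σ * ∏ l, X l (σ l) ω | sigmaExcept m X i] =ᵐ[P]
      fun ω => Q a σ * if σ i = 0 then ∏ l, X l (σ l) ω else 0 := by
    intro σ hσ
    have h1 := condExp_smul (μ := P) (Q a σ) (fun ω => ∏ l, X l (σ l) ω) (sigmaExcept m X i)
    have h2 := hX.condExp_monomial i (fun l => (mem_indexBox.1 hσ l).trans (hM l)) (hmono σ hσ)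
    filter_upwards [h1, h2] with ω w1 w2
    rw [← w2]
    exact w1
  have happ : (Q a).apply X = ∑ σ ∈ indexBox M, fun ω => Q a σ * ∏ l, X l (σ l) ω := by
    ext ω
    rw [hX.apply_eq_boxPoly (hQ a), Finset.sum_apply]
    exact Finset.sum_congr rfl fun σ hσ => by rw [hX.prodFun_ensembleVec hσ]
  have hce : ((Q a).apply X - P[(Q a).apply X | sigmaExcept m X i]) =ᵐ[P]
      fun ω => boxPoly coordFun M (activeCoeff i (Q a)) (ensembleVec M X ω) := by
    have h1 := condExp_finsetSum (μ := P) (fun σ hσ => (hmono σ hσ).const_mul (Q a σ))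
      (sigmaExcept m X i)
    have h2 := (Filter.eventually_all_finset (indexBox M)).2 hcm
    rw [happ]
    filter_upwards [h1, h2] with ω w1 w2
    rw [Pi.sub_apply, w1, Finset.sum_apply, Finset.sum_apply, ← Finset.sum_sub_distrib]
    refine Finset.sum_congr rfl fun σ hσ => ?_
    rw [w2 σ hσ, hX.prodFun_ensembleVec hσ, activeCoeff]
    split_ifs <;> simp
  unfold condVar
  rw [integral_condExp hle]
  have : ∀ᵐ ω ∂P, (((Q a).apply X - P[(Q a).apply X | sigmaExcept m X i]) ^ 2) ω =
      boxPoly coordFun M (activeCoeff i (Q a)) (ensembleVec M X ω) *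
      boxPoly coordFun M (activeCoeff i (Q a)) (ensembleVec M X ω) := by
    filter_upwards [hce] with ω hω
    rw [Pi.pow_apply, hω, sq]
  rw [integral_congr_ae this, hX.integral_boxPoly_mul_boxPoly hM hη hη1 h]
  simp only [sq]

end Moments

/-- The total influence of a polynomial of degree at most `d` is at most `d` times its variance. -/
theorem sum_activeCoeff_sq_le {n : ℕ} {M : Fin n → ℕ} {c : (Fin n → ℕ) → ℝ} {d : ℕ}
    (hd : ∀ σ ∈ indexBox M, c σ ≠ 0 → multiDegree σ ≤ d) :
    ∑ i, ∑ σ ∈ indexBox M, activeCoeff i c σ ^ 2 ≤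
      d * ∑ σ ∈ indexBox M, (if σ = 0 then 0 else c σ) ^ 2 := by
  rw [Finset.sum_comm, Finset.mul_sum]
  refine Finset.sum_le_sum fun σ hσ => ?_
  -- Each coefficient is counted once for every nonzero entry of its multi-index.
  have e : ∑ i, activeCoeff i c σ ^ 2 = multiDegree σ * c σ ^ 2 := by
    unfold multiDegree
    rw [← nsmul_eq_mul, ← Finset.sum_const, Finset.sum_filter]
    refine Finset.sum_congr rfl fun i _ => ?_
    unfold activeCoeff
    by_cases h : σ i = 0
    · simp [h]
    · simp [h, Nat.pos_of_ne_zero h]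
  rw [e]
  by_cases h0 : σ = 0
  · subst h0; simp [multiDegree]
  · rw [if_neg h0]
    by_cases hc : c σ = 0
    · simp [hc]
    · gcongr
      exact hd σ hσ hc

theorem multiDegree_le_of_vecDegree_le {n k d : ℕ} {Q : Fin k → MultilinearPoly n}
    (h : vecDegree Q ≤ d) (a : Fin k) {σ : Fin n → ℕ} (hσ : Q a σ ≠ 0) : multiDegree σ ≤ d :=
  (Finset.le_sup (f := multiDegree) (Finsupp.mem_support_iff.2 hσ)).trans
    ((Finset.le_sup (f := fun a => (Q a).degree) (Finset.mem_univ a)).trans h)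

end Invariance

end

theorem theorem4p1
    {n k d : ℕ} {α τ B : ℝ}
    -- the sequence of ensembles `X`: the `i`-th ensemble is a basis for the functions on the
    -- finite probability space `(S i, μ i)`, of which `ξ i` is the random point
    {Ω : Type*} [MeasurableSpace Ω] (P : Measure Ω) [IsProbabilityMeasure P]
    (m : Fin n → ℕ) (X : Fin n → ℕ → Ω → ℝ) (hX : Invariance.IsEnsembleSeq P m X)
    (S : Fin n → Type*) [∀ i, Finite (S i)] [∀ i, MeasurableSpace (S i)]
    [∀ i, MeasurableSingletonClass (S i)]
    (μ : ∀ i, Measure (S i)) [∀ i, IsProbabilityMeasure (μ i)]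
    (ξ : ∀ i, Ω → S i) (hξ : ∀ i, MeasurePreserving (ξ i) P (μ i))
    (b : ∀ i, ℕ → S i → ℝ) (hb : ∀ i, Invariance.IsFunctionBasis (μ i) (m i) (b i))
    (hXb : ∀ i, ∀ j ≤ m i, ∀ ω, X i j ω = b i j (ξ i ω))
    -- the least nonzero probability of an atom is `α ≤ 1/2`
    (hα : IsLeast {p : ℝ | p ≠ 0 ∧ ∃ (i : Fin n) (s : S i), p = (μ i).real {s}} α)
    (hα2 : α ≤ 1 / 2)
    -- the hypercontractive sequence of ensembles `Y`, made of independent random variables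
    {Ω' : Type*} [MeasurableSpace Ω'] (P' : Measure Ω') [IsProbabilityMeasure P']
    (m' : Fin n → ℕ) (Y : Fin n → ℕ → Ω' → ℝ) (hY : Invariance.IsEnsembleSeq P' m' Y)
    (hYhyp : Invariance.IsHypercontractive P' m' Y 2 3 (1 / 2 * α ^ (1 / 6 : ℝ)))
    (hYindep : iIndepFun (fun p : (Σ i : Fin n, Fin (m' i + 1)) => Y p.1 p.2) P')
    -- the polynomial
    (Q : Fin k → Invariance.MultilinearPoly n)
    (hQX : ∀ j, (Q j).IsOver m) (hQY : ∀ j, (Q j).IsOver m')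
    (hvar : Invariance.vecVariance P X Q ≤ 1)
    (hdeg : Invariance.vecDegree Q ≤ d)
    (hinf : ∀ i, Invariance.influence P m X Q i ≤ τ)
    -- the test function
    (Ψ : (Fin k → ℝ) → ℝ) (hΨ : ContDiff ℝ 3 Ψ)
    (hB : ∀ (a₁ a₂ a₃ : Fin k) (x : Fin k → ℝ),
      |Invariance.partialDeriv a₁ (Invariance.partialDeriv a₂
        (Invariance.partialDeriv a₃ Ψ)) x| ≤ B) :
    Integrable (fun ω => Ψ (Invariance.vecApply Q X ω)) P ∧
    Integrable (fun ω => Ψ (Invariance.vecApply Q Y ω)) P' ∧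
    |(∫ ω, Ψ (Invariance.vecApply Q X ω) ∂P) - ∫ ω, Ψ (Invariance.vecApply Q Y ω) ∂P'| ≤
      2 * d * B * (k : ℝ) ^ 3 * (8 * α ^ (-(1 / 2) : ℝ)) ^ d * τ ^ (1 / 2 : ℝ) := by
  open Invariance in
  obtain ⟨⟨hα0, i₀, s₀, hs₀⟩, hmin⟩ := hα
  have hαpos : 0 < α := lt_of_le_of_ne (hs₀ ▸ measureReal_nonneg) (Ne.symm hα0)
  have hatom : ∀ i s, (μ i).real {s} ≠ 0 → α ≤ (μ i).real {s} := fun i s h => hmin ⟨h, i, s, rfl⟩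
  set η : ℝ := 1 / 2 * α ^ (1 / 6 : ℝ) with hηdef
  have hη : 0 < η := by positivity
  have hη12 : η ≤ 1 / 2 := by
    have : α ^ (1 / 6 : ℝ) ≤ 1 := Real.rpow_le_one hαpos.le (by linarith) (by norm_num)
    rw [hηdef]; linarith
  have hη1 : η ≤ 1 := by linarith
  have hη2 : η ^ 2 ≤ 1 / 4 := by nlinarith
  have hη3 : η ^ 3 = √α / 8 := by
    rw [hηdef, mul_pow, ← Real.rpow_natCast (α ^ (1 / 6 : ℝ)), ← Real.rpow_mul hαpos.le,
      Real.sqrt_eq_rpow]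
    norm_num
    ring
  -- common truncation of the two sequences of ensembles
  set M : Fin n → ℕ := fun i => min (m i) (m' i) with hMdef
  have hM : ∀ i, M i ≤ m i := fun i => min_le_left _ _
  have hM' : ∀ i, M i ≤ m' i := fun i => min_le_right _ _
  have hQ : ∀ a, (Q a).IsOver M := fun a σ hσ i => le_min (hQX a σ hσ i) (hQY a σ hσ i)
  have blockX : ∀ i, IsHyperBlock coordFun η (M i) (ensembleLaw P M X i) := fun i =>
    hX.isHyperBlock hM fun c => hX.eLpNorm_block_le_of_finite i (μ i) (hξ i) (hXb i) hαpos
      (hatom i) hη hη2 hη3 (hM i) c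
  have blockY : ∀ i, IsHyperBlock coordFun η (M i) (ensembleLaw P' M Y i) := fun i =>
    hY.isHyperBlock hM' fun c => hY.eLpNorm_block_le_of_isHypercontractive hYhyp i (hM' i) c
  have appX : ∀ ω, vecApply Q X ω = fun a => boxPoly coordFun M (Q a) (ensembleVec M X ω) :=
    fun ω => funext fun a => hX.apply_eq_boxPoly (hQ a) ω
  have appY : ∀ ω, vecApply Q Y ω = fun a => boxPoly coordFun M (Q a) (ensembleVec M Y ω) :=
    fun ω => funext fun a => hY.apply_eq_boxPoly (hQ a) ω
  have := isProbabilityMeasure_ensembleLaw hX hM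
  have := isProbabilityMeasure_ensembleLaw hY hM'
  have hΨm : Measurable fun x : Fin n → ℕ → ℝ => Ψ fun a => boxPoly coordFun M (Q a) x :=
    hΨ.continuous.measurable.comp
      (measurable_pi_lambda _ fun a => measurable_boxPoly measurable_coordFun _)
  simp only [appX, appY]
  refine ⟨?_, ?_, ?_⟩
  · simpa using integrable_comp_add hΨ hB 0 fun a => hX.memLp_boxPoly hM hη hη1 blockX (Q a)
  · simpa using integrable_comp_add hΨ hB 0 fun a => hY.memLp_boxPoly hM' hη hη1 blockY (Q a)
  rw [integral_comp_of_measurePreserving (hX.measurePreserving hM) hΨm,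
    integral_comp_of_measurePreserving (hY.measurePreserving hM') hΨm]
  -- For `k = 0` there are no partial derivatives, so `B` may be negative; both sides of the
  -- inequality then vanish.
  rcases Nat.eq_zero_or_pos k with rfl | hk
  · have : ∀ x : Fin 0 → ℝ, Ψ x = Ψ 0 := fun x => congrArg Ψ (Subsingleton.elim _ _)
    simp only [this]
    simp
  have hB0 : 0 ≤ B := (abs_nonneg _).trans (hB ⟨0, hk⟩ ⟨0, hk⟩ ⟨0, hk⟩ 0)
  have hd : ∀ a, ∀ σ ∈ indexBox M, Q a σ ≠ 0 → multiDegree σ ≤ d := fun a σ _ h =>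
    multiDegree_le_of_vecDegree_le hdeg a h
  refine (abs_integral_pi_sub_le _ _ measurable_coordFun coordFun_zero hη hη1 blockX blockY hΨ hB
    hB0 hd).trans ?_
  set V : Fin k → Fin n → ℝ := fun a i => ∑ σ ∈ indexBox M, activeCoeff i (Q a) σ ^ 2 with hV
  have hV0 : ∀ a i, 0 ≤ V a i := fun a i => Finset.sum_nonneg fun σ _ => sq_nonneg _
  have hVτ : ∀ a i, V a i ≤ τ := fun a i =>
    (Finset.single_le_sum (f := fun a => V a i) (fun a _ => hV0 a i) (Finset.mem_univ a)).trans
      ((hX.influence_eq hM hη hη1 blockX hQ i).symm.le.trans (hinf i))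
  have hVsum : ∑ i, ∑ a, V a i ≤ d := by
    rw [Finset.sum_comm]
    rw [hX.vecVariance_eq hM hη hη1 blockX hQ] at hvar
    calc _ ≤ ∑ a, (d : ℝ) * ∑ σ ∈ indexBox M, (if σ = 0 then 0 else Q a σ) ^ 2 :=
          Finset.sum_le_sum fun a _ => sum_activeCoeff_sq_le (hd a)
      _ ≤ d := by
          rw [← Finset.mul_sum]
          exact mul_le_of_le_one_right (Nat.cast_nonneg d) hvar
  set K : ℝ := (8 * α ^ (-(1 / 2) : ℝ)) ^ d with hK
  have hK0 : 0 ≤ K := by positivity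
  have hηK : ((η⁻¹) ^ d) ^ 3 = K := by
    rw [← pow_mul, mul_comm, pow_mul, inv_pow, hη3, hK, Real.rpow_neg hαpos.le,
      ← Real.sqrt_eq_rpow, inv_div, div_eq_mul_inv]
  -- One factor `√(V a i)` is bounded by `√τ`; the remaining factor `V a i` is kept for the sum over
  -- `i`.
  have hterm : ∀ a i, ((η⁻¹) ^ d * √(V a i)) ^ 3 ≤ K * √τ * V a i := by
    intro a i
    rw [mul_pow, hηK, pow_succ, Real.sq_sqrt (hV0 a i), mul_assoc, mul_comm (√τ)]
    gcongr
    exact hVτ a i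
  calc _ ≤ ∑ i, 2 * B * ((k : ℝ) ^ 2 * ∑ a, K * √τ * V a i) := by
        gcongr with i _ a
        exact hterm a i
    _ = 2 * B * (k : ℝ) ^ 2 * K * √τ * ∑ i, ∑ a, V a i := by
        simp only [Finset.mul_sum]
        refine Finset.sum_congr rfl fun i _ => Finset.sum_congr rfl fun a _ => ?_
        ring
    -- The argument yields `k ^ 2`; the third factor `k` is slack, using `1 ≤ k`.
    _ ≤ 2 * B * (k : ℝ) ^ 3 * K * √τ * d := by
        gcongr
        · exact_mod_cast hk
        · norm_num
    _ = _ := by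
        rw [Real.sqrt_eq_rpow]
        ring
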